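/- Let $\Bbbk$ be a field of characteristic $0$ and $A$ an associative unital $\Bbbk$-algebra. Let $\Omega^nA=A\otimes(A/\Bbbk)^{\otimes n}$ be the space of noncommutative differential $n$-forms $a_0\,da_1\cdots da_n$, with its product and de Rham differential $d$, and let $\overline\Omega^0=A/\Bbbk$, $\overline\Omega^n=\Omega^nA$ for $n>0$. Consider the operators on forms induced by $$\mathsf b(\alpha\,da)=(-1)^{|\alpha|}(\alpha a-a\alpha),\qquad \kappa(\alpha\,da)=(-1)^{|\alpha|}da\,\alpha,\qquad \mathsf B(a_0\,da_1\cdots da_n)=\sum_{j=0}^n(-1)^{nj}da_{n-j+1}\cdots da_n\,da_0\cdots da_{n-j},$$ $$\imath_\Delta(a_0\,da_1\cdots da_n)=\sum_{l=1}^n(-1)^{(l-1)(n-l+1)}\,[a_l,\;da_{l+1}\cdots da_n\,a_0\,da_1\cdots da_{l-1}],$$ where $\mathsf b=\imath_\Delta=0$ and $\kappa=\mathrm{Id}$ on $\Omega^0A$. Let $t$ be a variable of degree $2$, and let $$\mathcal M=\bigoplus_{m\in\mathbb Z}\prod_{i\in\mathbb Z}t^i\,\overline\Omega^{m-2i},\qquad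 \mathcal M_+=\bigoplus_{m}\prod_{i<m}t^i\,\overline\Omega^{m-2i},\qquad \mathcal M_{\ge0}=\bigoplus_{m}\prod_{i\le m}t^i\,\overline\Omega^{m-2i},$$ with all operators extended $\Bbbk[t,t^{-1}]$-linearly to $\mathcal M$. Reduced cyclic and negative cyclic homology are the graded $\Bbbk[t]$-modules $$HC_\bullet=H^{-\bullet}(\mathcal M/\mathcal M_+,\ \mathsf B+t\mathsf b),\qquad HC^-_\bullet=H^{-\bullet}(\mathcal M_{\ge0},\ \mathsf B+t\mathsf b).$$ Define likewise $${}^\heartsuit HC_\bullet=H^{-\bullet}(\mathcal M/\mathcal M_+,\ d+t\,\imath_\Delta),\qquad {}^\heartsuit HC^-_\bullet=H^{-\bullet}(\mathcal M_{\ge0},\ d+t\,\imath_\Delta),$$ and let $P({}^\heartsuit HC_\bullet)$ and $P({}^\heartsuit HC^-_\bullet)$ be their harmonic parts, i.e. the submodules of the classes represented by cycles in $\operatorname{Ker}(\mathrm{Id}-\kappa)^2$. Then there are isomorphisms of graded $\Bbbk[t]$-modules, natural with respect to unital $\Bbbk$-algebra homomorphisms, $$P({}^\heartsuit HC_\bullet)\cong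 HC_\bullet\qquad\text{and}\qquad P({}^\heartsuit HC^-_\bullet)\cong HC^-_\bullet .$$ -/

import Mathlib

open scoped TensorProduct

universe u v

namespace NCForms

noncomputable section

section Forms

variable (k : Type v) [Field k] (A : Type u) [Ring A] [Algebra k A]

/-- The quotient space `A / k·1`. -/
abbrev Abar : Type u := A ⧸ Submodule.span k {(1 : A)}

/-- Noncommutative differential `n`-forms, `Ω^n A = A ⊗ (A/k)^{⊗ n}`, built up one factor at a time:
`Ω^{n+1} A = Ω^n A ⊗ A/k`, where `ω ⊗ ā` stands for the form `ω da`. -/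
def Om : ℕ → ModuleCat.{u} k
  | 0 => ModuleCat.of k A
  | n + 1 => ModuleCat.of k ((Om n : Type u) ⊗[k] Abar k A)

/-- The identification of `A` with `Ω^0 A`. -/
def zeroEquiv : A ≃ₗ[k] Om k A 0 := LinearEquiv.refl k A

/-- The identification of `Ω^n A ⊗ A/k` with `Ω^{n+1} A`. -/
def succEquiv (n : ℕ) : (Om k A n ⊗[k] Abar k A) ≃ₗ[k] Om k A (n + 1) :=
  LinearEquiv.refl k (Om k A n ⊗[k] Abar k A)

variable {k A}

/-- `mulD n ω a = ω da`. -/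
def mulD (n : ℕ) : Om k A n →ₗ[k] A →ₗ[k] Om k A (n + 1) :=
  ((TensorProduct.mk k (Om k A n) (Abar k A)).compl₂ (Submodule.span k {(1 : A)}).mkQ).compr₂
    (succEquiv k A n).toLinearMap

/-- A bilinear function `f ω a` that vanishes at `a = 1` defines a linear map on `(n+1)`-forms,
sending `ω da` to `f ω a`. -/
def lift {n : ℕ} {M : Type*} [AddCommGroup M] [Module k M]
    (f : Om k A n →ₗ[k] A →ₗ[k] M) (hf : ∀ ω, f ω 1 = 0) : Om k A (n + 1) →ₗ[k] M :=
  TensorProduct.lift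
    (((Submodule.span k {(1 : A)}).liftQ f.flip (by
      rw [Submodule.span_singleton_le_iff_mem, LinearMap.mem_ker]
      ext ω
      simpa using hf ω)).flip) ∘ₗ (succEquiv k A n).symm.toLinearMap

@[simp]
theorem lift_mulD {n : ℕ} {M : Type*} [AddCommGroup M] [Module k M]
    (f : Om k A n →ₗ[k] A →ₗ[k] M) (hf : ∀ ω, f ω 1 = 0) (ω : Om k A n) (a : A) :
    lift f hf (mulD n ω a) = f ω a := by
  simp [lift, mulD]

@[simp]
theorem mulD_one (n : ℕ) (ω : Om k A n) : mulD n ω (1 : A) = 0 := by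
  have h : (Submodule.Quotient.mk (1 : A) : Abar k A) = 0 := by
    simp [Submodule.mem_span_singleton_self]
  simp [mulD, h]

theorem hom_ext {n : ℕ} {M : Type*} [AddCommGroup M] [Module k M]
    {f g : Om k A (n + 1) →ₗ[k] M} (h : ∀ ω a, f (mulD n ω a) = g (mulD n ω a)) : f = g := by
  have : f ∘ₗ (succEquiv k A n).toLinearMap = g ∘ₗ (succEquiv k A n).toLinearMap := by
    refine TensorProduct.ext' (fun ω a => ?_)
    obtain ⟨a, rfl⟩ := Submodule.mkQ_surjective _ a
    exact h ω a
  ext ω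
  obtain ⟨ω, rfl⟩ := (succEquiv k A n).surjective ω
  exact LinearMap.congr_fun this ω

/-- Left multiplication `lmul n c ω = c ω`, with `c (ω da) = (c ω) da`. -/
def lmul : (n : ℕ) → A →ₗ[k] Om k A n →ₗ[k] Om k A n
  | 0 => ((LinearMap.mul k A).compl₂ (zeroEquiv k A).symm.toLinearMap).compr₂
      (zeroEquiv k A).toLinearMap
  | n + 1 => (lift (n := n) (M := A →ₗ[k] Om k A (n + 1))
      (LinearMap.mk₂ k (fun ω a => (mulD n).flip a ∘ₗ (lmul n).flip ω)
        (by intros; ext; simp) (by intros; ext; simp)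
        (by intros; ext; simp) (by intros; ext; simp))
      (by intro ω; ext c; simp)).flip

/-- Right multiplication `ω c`, with `(ω da) c = ω d(ac) - (ω a) dc`, together with `ω 1 = ω`. -/
def rmulAux : (n : ℕ) → {f : Om k A n →ₗ[k] A →ₗ[k] Om k A n // ∀ ω, f ω 1 = ω}
  | 0 => ⟨((LinearMap.mul k A) ∘ₗ (zeroEquiv k A).symm.toLinearMap).compr₂
      (zeroEquiv k A).toLinearMap, fun ω => by simp⟩
  | n + 1 =>
    ⟨lift (n := n) (M := A →ₗ[k] Om k A (n + 1))
      (LinearMap.mk₂ k (fun ω a => mulD n ω ∘ₗ (LinearMap.mulLeft k a : A →ₗ[k] A))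
          (by intros; ext; simp) (by intros; ext; simp)
          (by intros; ext; simp [add_mul]) (by intros; ext; simp) -
        (rmulAux n).1.compr₂ (mulD n))
      (by intro ω; ext c; simp [(rmulAux n).2]), by
      intro ω
      refine LinearMap.congr_fun (f := LinearMap.flip (lift (n := n) (M := A →ₗ[k] Om k A (n + 1)) _ _) (1 : A))
        (g := LinearMap.id)
        (hom_ext fun ω a => ?_) ω
      simp⟩

/-- Right multiplication `rmul n ω c = ω c`. -/
def rmul (n : ℕ) : Om k A n →ₗ[k] A →ₗ[k] Om k A n := (rmulAux n).1

/-- The unit `1 ∈ A = Ω^0 A`. -/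
def one : Om k A 0 := zeroEquiv k A 1

/-- The product of forms `mul p q ω η = ω η`, with `ω (η da) = (ω η) da`. -/
def mul (p : ℕ) : (q : ℕ) → Om k A p →ₗ[k] Om k A q →ₗ[k] Om k A (p + q)
  | 0 => (rmul p).compl₂ (zeroEquiv k A).symm.toLinearMap
  | q + 1 => (lift (n := q) (M := Om k A p →ₗ[k] Om k A (p + q + 1))
      (LinearMap.mk₂ k (fun η a => (mulD (p + q)).flip a ∘ₗ (mul p q).flip η)
        (by intros; ext; simp) (by intros; ext; simp)
        (by intros; ext; simp) (by intros; ext; simp))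
      (by intro ω; ext c; simp)).flip

/-- The de Rham differential, `d a = 1 da` and `d (ω da) = (d ω) da`. -/
def d : (n : ℕ) → Om k A n →ₗ[k] Om k A (n + 1)
  | 0 => mulD 0 one ∘ₗ (zeroEquiv k A).symm.toLinearMap
  | n + 1 => lift (mulD (n + 1) ∘ₗ d n) (by intro ω; simp)

/-- Left multiplication by an exact one-form, `dmul n a ω = da ω = d(a ω) - a dω`. -/
def dmul (n : ℕ) : A →ₗ[k] Om k A n →ₗ[k] Om k A (n + 1) :=
  (lmul n).compr₂ (d n) - (lmul (n + 1)).compl₂ (d n)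

@[simp]
theorem lmul_one : (n : ℕ) → (ω : Om k A n) → lmul n (1 : A) ω = ω
  | 0, ω => by simp [lmul]
  | n + 1, ω => by
    refine LinearMap.congr_fun (f := lmul (n + 1) 1) (g := LinearMap.id)
      (hom_ext fun ω a => ?_) ω
    simp [lmul, lmul_one n]

@[simp]
theorem rmul_one (n : ℕ) (ω : Om k A n) : rmul n ω (1 : A) = ω := (rmulAux n).2 ω

@[simp]
theorem dmul_one (n : ℕ) (ω : Om k A n) : dmul n (1 : A) ω = 0 := by simp [dmul]

/-- The Hochschild differential `b (ω da) = (-1)^{|ω|} (ω a - a ω)`; it vanishes on `Ω^0 A`. -/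
def b (n : ℕ) : Om k A (n + 1) →ₗ[k] Om k A n :=
  lift ((-1 : k) ^ n • (rmul n - (lmul n).flip)) (by intro ω; simp)

/-- The Karoubi operator `κ (ω da) = (-1)^{|ω|} da ω`; it is the identity on `Ω^0 A`. -/
def karoubi : (n : ℕ) → Om k A n →ₗ[k] Om k A n
  | 0 => LinearMap.id
  | n + 1 => lift ((-1 : k) ^ n • (dmul n).flip) (by intro ω; simp)

/-- Connes' differential
`B (a₀ da₁ … daₙ) = ∑_{j=0}^{n} (-1)^{n j} da_{n-j+1} … daₙ da₀ da₁ … da_{n-j}`;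
the signed cyclic rotation of `da₀ da₁ … daₙ` is its image under the Karoubi operator. -/
def connes (n : ℕ) : Om k A n →ₗ[k] Om k A (n + 1) :=
  ∑ j ∈ Finset.range (n + 1), ((karoubi (n + 1) : Module.End k (Om k A (n + 1))) ^ j) ∘ₗ d n

/-- The identity map of `Ω^i A`, for equal degrees `i = j`. -/
def castOm {i j : ℕ} (h : i = j) : Om k A i →ₗ[k] Om k A j :=
  (LinearEquiv.cast (R := k) (M := fun n => Om k A n) h).toLinearMap

/-- The bilinear map sending `ω = a₀ da₁ … daₙ` and a form `η` of degree `p` to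
`∑_{l=1}^{n} (-1)^{(l-1)(n+p-l+1)} [a_l, da_{l+1} … daₙ η a₀ da₁ … da_{l-1}]`,
defined by splitting off the last factor `daₙ` of `ω`. Here `N = n + p - 1` is the degree of
the result. -/
def contract : (n p N : ℕ) → n + p = N + 1 → Om k A n →ₗ[k] Om k A p →ₗ[k] Om k A N
  | 0, _, _, _ => 0
  | n + 1, p, N, h =>
    lift (n := n) (M := Om k A p →ₗ[k] Om k A N)
      (LinearMap.mk₂ k (fun ω a =>
          contract n (p + 1) N (by omega) ω ∘ₗ dmul p a +
          (-1 : k) ^ (n * (p + 1)) •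
            (castOm (show p + n = N by omega) ∘ₗ
              ((lmul (p + n) a - (rmul (p + n)).flip a) ∘ₗ (mul p n).flip ω)))
        (by intros; ext; simp; module) (by intros; ext; simp; module)
        (by intros; ext; simp; module) (by intros; ext; simp; module))
      (by intro ω; ext η; simp)

/-- The reduced contraction with the double derivation `Δ a = 1 ⊗ a - a ⊗ 1`. With
`i_Δ (a₀ da₁) = a₀ ⊗ a₁ - a₀ a₁ ⊗ 1` it is given, for one-forms `α₁, …, αₙ`, by
`α₁ … αₙ ↦ ∑_l (-1)^{(l-1)(n-l+1)} (i_Δ'' α_l) α_{l+1} … αₙ α₁ … α_{l-1} (i_Δ' α_l)`,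
that is,
`a₀ da₁ … daₙ ↦ ∑_l (-1)^{(l-1)(n-l+1)} [a_l, da_{l+1} … daₙ a₀ da₁ … da_{l-1}]`. -/
def iDelta (n : ℕ) : Om k A (n + 1) →ₗ[k] Om k A n :=
  (contract (n + 1) 0 n rfl).flip one

variable {A' : Type u} [Ring A'] [Algebra k A']

/-- The map on forms induced by an algebra homomorphism,
`a₀ da₁ … daₙ ↦ f(a₀) d f(a₁) … d f(aₙ)`. -/
def omMap (f : A →ₐ[k] A') : (n : ℕ) → Om k A n →ₗ[k] Om k A' n
  | 0 => (zeroEquiv k A').toLinearMap ∘ₗ f.toLinearMap ∘ₗ (zeroEquiv k A).symm.toLinearMap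
  | n + 1 => lift ((mulD n).compl₁₂ (omMap f n) f.toLinearMap) (by intro ω; simp)

@[simp]
theorem omMap_mulD (f : A →ₐ[k] A') (n : ℕ) (ω : Om k A n) (a : A) :
    omMap f (n + 1) (mulD n ω a) = mulD n (omMap f n ω) (f a) := by
  simp [omMap]

@[simp]
theorem omMap_zero (f : A →ₐ[k] A') (a : A) :
    omMap f 0 (zeroEquiv k A a) = zeroEquiv k A' (f a) := by
  simp [omMap]

theorem om_induction {P : (n : ℕ) → Om k A n → Prop} (h0 : ∀ a, P 0 (zeroEquiv k A a))
    (hadd : ∀ n ω η, P n ω → P n η → P n (ω + η))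
    (hz : ∀ n, P n 0)
    (hs : ∀ n ω a, P n ω → P (n + 1) (mulD n ω a)) : (n : ℕ) → (ω : Om k A n) → P n ω
  | 0, ω => by
    obtain ⟨a, rfl⟩ := (zeroEquiv k A).surjective ω
    exact h0 a
  | n + 1, ω => by
    obtain ⟨x, rfl⟩ := (succEquiv k A n).surjective ω
    induction x with
    | zero => rw [map_zero]; exact hz _
    | add x y hx hy => rw [map_add]; exact hadd _ _ _ hx hy
    | tmul ω a =>
      obtain ⟨a, rfl⟩ := Submodule.mkQ_surjective _ a
      exact hs n ω a (om_induction h0 hadd hz hs n ω)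

theorem lmul_zero_apply (a c : A) :
    lmul 0 c (zeroEquiv k A a) = zeroEquiv k A (c * a) := by simp [lmul]

theorem lmul_mulD (n : ℕ) (c : A) (ω : Om k A n) (a : A) :
    lmul (n + 1) c (mulD n ω a) = mulD n (lmul n c ω) a := by simp [lmul]

theorem rmul_zero_apply (a c : A) :
    rmul 0 (zeroEquiv k A a) c = zeroEquiv k A (a * c) := by simp [rmul, rmulAux]

theorem rmul_mulD (n : ℕ) (c : A) (ω : Om k A n) (a : A) :
    rmul (n + 1) (mulD n ω a) c = mulD n ω (a * c) - mulD n (rmul n ω a) c := by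
  simp [rmul, rmulAux]

theorem mul_zero_apply (p : ℕ) (ω : Om k A p) (a : A) :
    mul p 0 ω (zeroEquiv k A a) = rmul p ω a := by simp [mul]

theorem mul_mulD (p q : ℕ) (ω : Om k A p) (η : Om k A q) (a : A) :
    mul p (q + 1) ω (mulD q η a) = mulD (p + q) (mul p q ω η) a := by simp [mul]

theorem d_mulD (n : ℕ) (ω : Om k A n) (a : A) :
    d (n + 1) (mulD n ω a) = mulD (n + 1) (d n ω) a := by simp [d]

theorem b_mulD (n : ℕ) (ω : Om k A n) (a : A) :
    b n (mulD n ω a) = (-1 : k) ^ n • (rmul n ω a - lmul n a ω) := by simp [b]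

theorem karoubi_mulD (n : ℕ) (ω : Om k A n) (a : A) :
    karoubi (n + 1) (mulD n ω a) = (-1 : k) ^ n • dmul n a ω := by simp [karoubi]

theorem contract_mulD (n p N : ℕ) (h : n + 1 + p = N + 1) (ω : Om k A n) (a : A) (η : Om k A p) :
    contract (n + 1) p N h (mulD n ω a) η =
      contract n (p + 1) N (by omega) ω (dmul p a η) +
      (-1 : k) ^ (n * (p + 1)) • castOm (show p + n = N by omega)
        (lmul (p + n) a (mul p n η ω) - rmul (p + n) (mul p n η ω) a) := by
  simp [contract]

section Naturality

variable (f : A →ₐ[k] A')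

theorem omMap_lmul (c : A) (n : ℕ) (ω : Om k A n) :
    omMap f n (lmul n c ω) = lmul n (f c) (omMap f n ω) := by
  refine om_induction (P := fun n ω => omMap f n (lmul n c ω) = lmul n (f c) (omMap f n ω))
    ?_ ?_ ?_ ?_ n ω
  · intro a; simp [lmul_zero_apply]
  · intro n ω η h h'; simp [h, h']
  · intro n; simp
  · intro n ω a h; simp [lmul_mulD, h]

theorem omMap_rmul (n : ℕ) (ω : Om k A n) :
    ∀ c : A, omMap f n (rmul n ω c) = rmul n (omMap f n ω) (f c) := by
  refine om_induction
    (P := fun n ω => ∀ c : A, omMap f n (rmul n ω c) = rmul n (omMap f n ω) (f c))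
    ?_ ?_ ?_ ?_ n ω
  · intro a c; simp [rmul_zero_apply]
  · intro n ω η h h' c; simp [h, h']
  · intro n; simp
  · intro n ω a h c; simp [rmul_mulD, h]

theorem omMap_mul (p : ℕ) (ω : Om k A p) (q : ℕ) (η : Om k A q) :
    omMap f (p + q) (mul p q ω η) = mul p q (omMap f p ω) (omMap f q η) := by
  refine om_induction
    (P := fun q η => omMap f (p + q) (mul p q ω η) = mul p q (omMap f p ω) (omMap f q η))
    ?_ ?_ ?_ ?_ q η
  · intro a; simp [mul_zero_apply, omMap_rmul]
  · intro n ω η h h'; simp [h, h']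
  · intro n; simp
  · intro n ω a h
    rw [mul_mulD, omMap_mulD, mul_mulD, ← h]
    exact omMap_mulD f (p + n) _ a

theorem omMap_d (n : ℕ) (ω : Om k A n) : omMap f (n + 1) (d n ω) = d n (omMap f n ω) := by
  refine om_induction (P := fun n ω => omMap f (n + 1) (d n ω) = d n (omMap f n ω))
    ?_ ?_ ?_ ?_ n ω
  · intro a; simp [d, one]
  · intro n ω η h h'; simp [h, h']
  · intro n; simp
  · intro n ω a h; simp [d_mulD, h]

theorem omMap_dmul (n : ℕ) (a : A) (ω : Om k A n) :
    omMap f (n + 1) (dmul n a ω) = dmul n (f a) (omMap f n ω) := by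
  simp [dmul, omMap_d, omMap_lmul]

theorem omMap_b (n : ℕ) (ω : Om k A (n + 1)) :
    omMap f n (b n ω) = b n (omMap f (n + 1) ω) := by
  refine LinearMap.congr_fun (f := omMap f n ∘ₗ b n) (g := b n ∘ₗ omMap f (n + 1))
    (hom_ext fun ω a => ?_) ω
  simp [b_mulD, omMap_rmul, omMap_lmul]

theorem omMap_karoubi : (n : ℕ) → (ω : Om k A n) →
    omMap f n (karoubi n ω) = karoubi n (omMap f n ω)
  | 0, ω => rfl
  | n + 1, ω => by
    refine LinearMap.congr_fun (f := omMap f (n + 1) ∘ₗ karoubi (n + 1))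
      (g := karoubi (n + 1) ∘ₗ omMap f (n + 1)) (hom_ext fun ω a => ?_) ω
    simp [karoubi_mulD, omMap_dmul]

theorem omMap_connes (n : ℕ) (ω : Om k A n) :
    omMap f (n + 1) (connes n ω) = connes n (omMap f n ω) := by
  have h : ∀ (j : ℕ) (η : Om k A (n + 1)),
      omMap f (n + 1) (((karoubi (n + 1) : Module.End k (Om k A (n + 1))) ^ j) η) =
        ((karoubi (n + 1) : Module.End k (Om k A' (n + 1))) ^ j) (omMap f (n + 1) η) := by
    intro j
    induction j with
    | zero => intro η; rfl
    | succ j ih => intro η; simp [pow_succ, ih, omMap_karoubi]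
  simp [connes, h, omMap_d]

theorem omMap_castOm {i j : ℕ} (h : i = j) (ω : Om k A i) :
    omMap f j (castOm h ω) = castOm h (omMap f i ω) := by
  subst h; rfl

theorem omMap_contract (n : ℕ) : ∀ (p N : ℕ) (h : n + p = N + 1) (ω : Om k A n) (η : Om k A p),
    omMap f N (contract n p N h ω η) = contract n p N h (omMap f n ω) (omMap f p η) := by
  induction n with
  | zero => intro p N h ω η; simp [contract]
  | succ n ih =>
    intro p N h ω η
    refine LinearMap.congr_fun (f := omMap f N ∘ₗ (contract (n + 1) p N h).flip η)
      (g := (contract (n + 1) p N h).flip (omMap f p η) ∘ₗ omMap f (n + 1))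
      (hom_ext fun ω a => ?_) ω
    simp [contract_mulD, ih, omMap_castOm, omMap_lmul, omMap_rmul, omMap_dmul, omMap_mul]

theorem omMap_iDelta (n : ℕ) (ω : Om k A (n + 1)) :
    omMap f n (iDelta n ω) = iDelta n (omMap f (n + 1) ω) := by
  simp [iDelta, omMap_contract, one]

end Naturality

end Forms

section Reduced

variable (k : Type v) [Field k] (A : Type u) [Ring A] [Algebra k A]

/-- Reduced forms: `Ω^0 A` is replaced by `A / k·1`. -/
def RedOm : ℕ → ModuleCat.{u} k
  | 0 => ModuleCat.of k (Abar k A)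
  | n + 1 => Om k A (n + 1)

/-- The projection from forms to reduced forms. -/
def redProj : (n : ℕ) → Om k A n →ₗ[k] RedOm k A n
  | 0 => (Submodule.span k {(1 : A)}).mkQ ∘ₗ (zeroEquiv k A).symm.toLinearMap
  | _ + 1 => LinearMap.id

variable {k A}

theorem redProj_surjective : (n : ℕ) → Function.Surjective (redProj k A n)
  | 0 => (Submodule.mkQ_surjective _).comp (zeroEquiv k A).symm.surjective
  | _ + 1 => Function.surjective_id

/-- A linear map on forms that kills the constants `k·1 ⊆ A = Ω^0 A`, as a map on reduced forms. -/
def redDesc {M : Type*} [AddCommGroup M] [Module k M] :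
    (n : ℕ) → (g : Om k A n →ₗ[k] M) → (∀ h : n = 0, g (castOm h.symm one) = 0) →
      (RedOm k A n →ₗ[k] M)
  | 0, g, hg => (Submodule.span k {(1 : A)}).liftQ (g ∘ₗ (zeroEquiv k A).toLinearMap) (by
      rw [Submodule.span_singleton_le_iff_mem, LinearMap.mem_ker]
      exact hg rfl)
  | _ + 1, g, _ => g

@[simp]
theorem redDesc_redProj {M : Type*} [AddCommGroup M] [Module k M] : (n : ℕ) →
    (g : Om k A n →ₗ[k] M) → (hg : ∀ h : n = 0, g (castOm h.symm one) = 0) → (ω : Om k A n) →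
      redDesc n g hg (redProj k A n ω) = g ω
  | 0, _, _, _ => rfl
  | _ + 1, _, _, _ => rfl

theorem d_const (n : ℕ) (h : n = 0) : d n (castOm h.symm (one : Om k A 0)) = 0 := by
  subst h
  change d 0 one = 0
  simp [d, one]

theorem connes_const (n : ℕ) (h : n = 0) : connes n (castOm h.symm (one : Om k A 0)) = 0 := by
  simp [connes, d_const n h]

/-- The de Rham differential on reduced forms. -/
def dRed (n : ℕ) : RedOm k A n →ₗ[k] RedOm k A (n + 1) :=
  redDesc n (redProj k A (n + 1) ∘ₗ d n) (fun h => by simp [d_const n h])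

/-- Connes' differential on reduced forms. -/
def connesRed (n : ℕ) : RedOm k A n →ₗ[k] RedOm k A (n + 1) :=
  redDesc n (redProj k A (n + 1) ∘ₗ connes n) (fun h => by simp [connes_const n h])

theorem redProj_const (n : ℕ) (h : n = 0) : redProj k A n (castOm h.symm one) = 0 := by
  subst h
  change (Submodule.span k {(1 : A)}).mkQ 1 = 0
  simp [Submodule.mem_span_singleton_self]

theorem karoubi_const (n : ℕ) (h : n = 0) :
    karoubi n (castOm h.symm (one : Om k A 0)) = castOm h.symm one := by
  subst h
  rfl

/-- The Karoubi operator on reduced forms. -/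
def karoubiRed (n : ℕ) : RedOm k A n →ₗ[k] RedOm k A n :=
  redDesc n (redProj k A n ∘ₗ karoubi n)
    (fun h => by simp [karoubi_const n h, redProj_const n h])

/-- The Hochschild differential on reduced forms. -/
def bRed (n : ℕ) : RedOm k A (n + 1) →ₗ[k] RedOm k A n :=
  redDesc (n + 1) (redProj k A n ∘ₗ b n) (fun h => absurd h n.succ_ne_zero)

/-- The reduced contraction with `Δ` on reduced forms. -/
def iDeltaRed (n : ℕ) : RedOm k A (n + 1) →ₗ[k] RedOm k A n :=
  redDesc (n + 1) (redProj k A n ∘ₗ iDelta n) (fun h => absurd h n.succ_ne_zero)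

variable {A' : Type u} [Ring A'] [Algebra k A']

theorem omMap_const (f : A →ₐ[k] A') (n : ℕ) (h : n = 0) :
    omMap f n (castOm h.symm (one : Om k A 0)) = castOm h.symm one := by
  subst h
  change omMap f 0 one = one
  simp [one]

/-- The map on reduced forms induced by an algebra homomorphism. -/
def redMap (f : A →ₐ[k] A') (n : ℕ) : RedOm k A n →ₗ[k] RedOm k A' n :=
  redDesc n (redProj k A' n ∘ₗ omMap f n)
    (fun h => by simp [omMap_const f n h, redProj_const n h])

@[simp]
theorem redMap_redProj (f : A →ₐ[k] A') (n : ℕ) (ω : Om k A n) :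
    redMap f n (redProj k A n ω) = redProj k A' n (omMap f n ω) := by
  simp [redMap]

theorem redMap_dRed (f : A →ₐ[k] A') (n : ℕ) (x : RedOm k A n) :
    redMap f (n + 1) (dRed n x) = dRed n (redMap f n x) := by
  obtain ⟨ω, rfl⟩ := redProj_surjective n x
  simp [dRed, omMap_d]

theorem redMap_connesRed (f : A →ₐ[k] A') (n : ℕ) (x : RedOm k A n) :
    redMap f (n + 1) (connesRed n x) = connesRed n (redMap f n x) := by
  obtain ⟨ω, rfl⟩ := redProj_surjective n x
  simp [connesRed, omMap_connes]

theorem redMap_karoubiRed (f : A →ₐ[k] A') (n : ℕ) (x : RedOm k A n) :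
    redMap f n (karoubiRed n x) = karoubiRed n (redMap f n x) := by
  obtain ⟨ω, rfl⟩ := redProj_surjective n x
  simp [karoubiRed, omMap_karoubi]

theorem redMap_bRed (f : A →ₐ[k] A') (n : ℕ) (x : RedOm k A (n + 1)) :
    redMap f n (bRed n x) = bRed n (redMap f (n + 1) x) := by
  obtain ⟨ω, rfl⟩ := redProj_surjective (n + 1) x
  simp [bRed, omMap_b]

theorem redMap_iDeltaRed (f : A →ₐ[k] A') (n : ℕ) (x : RedOm k A (n + 1)) :
    redMap f n (iDeltaRed n x) = iDeltaRed n (redMap f (n + 1) x) := by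
  obtain ⟨ω, rfl⟩ := redProj_surjective (n + 1) x
  simp [iDeltaRed, omMap_iDelta]

end Reduced

section Laurent

variable (k : Type v) [Field k] (A : Type u) [Ring A] [Algebra k A]

/-- All families `x = ∑ tⁱ x i j` with `i ∈ ℤ` and `x i j` a reduced `j`-form. -/
abbrev Laurent : Type u := (i : ℤ) → (j : ℕ) → RedOm k A j

/-- The degree `m` part `∏_i tⁱ Ω̄^{m-2i}`, where `t` has degree `2`. The direct sum of these parts
over all `m ∈ ℤ` is the graded `k[t,t⁻¹]`-module of reduced forms with coefficients in `k[t,t⁻¹]`,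
completed in each degree. -/
def degPart (m : ℤ) : Submodule k (Laurent k A) where
  carrier := {x | ∀ (i : ℤ) (j : ℕ), (j : ℤ) + 2 * i ≠ m → x i j = 0}
  add_mem' hx hy i j h := by simp [hx i j h, hy i j h]
  zero_mem' _ _ _ := rfl
  smul_mem' c x hx i j h := by simp [hx i j h]

/-- The subspace with degree `m` part `∏_{i < m} tⁱ Ω̄^{m-2i}`. -/
def plusPart : Submodule k (Laurent k A) where
  carrier := {x | ∀ (i : ℤ) (j : ℕ), ¬ i < (j : ℤ) + 2 * i → x i j = 0}
  add_mem' hx hy i j h := by simp [hx i j h, hy i j h]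
  zero_mem' _ _ _ := rfl
  smul_mem' c x hx i j h := by simp [hx i j h]

/-- The subspace with degree `m` part `∏_{i ≤ m} tⁱ Ω̄^{m-2i}`. -/
def nonnegPart : Submodule k (Laurent k A) where
  carrier := {x | ∀ (i : ℤ) (j : ℕ), ¬ i ≤ (j : ℤ) + 2 * i → x i j = 0}
  add_mem' hx hy i j h := by simp [hx i j h, hy i j h]
  zero_mem' _ _ _ := rfl
  smul_mem' c x hx i j h := by simp [hx i j h]

/-- Multiplication by `t`. -/
def tMul : Laurent k A →ₗ[k] Laurent k A where
  toFun x i j := x (i - 1) j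
  map_add' _ _ := rfl
  map_smul' _ _ := rfl

variable {k A}

/-- The operator `δ + t β`, for `δ` of degree `1` and `β` of degree `-1` on reduced forms. -/
def totalD (δ : (j : ℕ) → RedOm k A j →ₗ[k] RedOm k A (j + 1))
    (β : (j : ℕ) → RedOm k A (j + 1) →ₗ[k] RedOm k A j) : Laurent k A →ₗ[k] Laurent k A where
  toFun x i j :=
    match j with
    | 0 => β 0 (x (i - 1) 1)
    | j + 1 => δ j (x i j) + β (j + 1) (x (i - 1) (j + 2))
  map_add' x y := by
    ext i j
    cases j <;> simp
    abel
  map_smul' c x := by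
    ext i j
    cases j <;> simp

variable (k A)

/-- The differential `B + t b`. -/
def cycD : Laurent k A →ₗ[k] Laurent k A := totalD connesRed bRed

/-- The differential `d + t ı_Δ`. -/
def heartD : Laurent k A →ₗ[k] Laurent k A := totalD dRed iDeltaRed

/-- The Karoubi operator, extended linearly over `k[t,t⁻¹]`. -/
def karoubiL : Laurent k A →ₗ[k] Laurent k A where
  toFun x i j := karoubiRed j (x i j)
  map_add' _ _ := by ext; simp
  map_smul' _ _ := by ext; simp

variable {k A}

theorem totalD_tMul (δ : (j : ℕ) → RedOm k A j →ₗ[k] RedOm k A (j + 1))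
    (β : (j : ℕ) → RedOm k A (j + 1) →ₗ[k] RedOm k A j) (x : Laurent k A) :
    totalD δ β (tMul k A x) = tMul k A (totalD δ β x) := by
  ext i j
  cases j <;> rfl

theorem totalD_plusPart (δ : (j : ℕ) → RedOm k A j →ₗ[k] RedOm k A (j + 1))
    (β : (j : ℕ) → RedOm k A (j + 1) →ₗ[k] RedOm k A j) :
    plusPart k A ≤ (plusPart k A).comap (totalD δ β) := by
  intro x hx i j h
  cases j with
  | zero =>
    have h1 := hx (i - 1) 1 (by push_cast at h ⊢; omega)
    simp [totalD, h1]
  | succ j =>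
    have h1 := hx i j (by push_cast at h ⊢; omega)
    have h2 := hx (i - 1) (j + 2) (by push_cast at h ⊢; omega)
    simp [totalD, h1, h2]

theorem tMul_plusPart : plusPart k A ≤ (plusPart k A).comap (tMul k A) :=
  fun _ hx i j h => hx (i - 1) j (by omega)

theorem karoubiL_plusPart : plusPart k A ≤ (plusPart k A).comap (karoubiL k A) :=
  fun x hx i j h => by simp [karoubiL, hx i j h]

theorem tMul_degPart (m : ℤ) : degPart k A m ≤ (degPart k A (m + 2)).comap (tMul k A) :=
  fun _ hx i j h => hx (i - 1) j (by omega)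

theorem tMul_nonnegPart : nonnegPart k A ≤ (nonnegPart k A).comap (tMul k A) :=
  fun _ hx i j h => hx (i - 1) j (by omega)

theorem karoubiL_tMul (x : Laurent k A) :
    karoubiL k A (tMul k A x) = tMul k A (karoubiL k A x) := rfl

variable {A' : Type u} [Ring A'] [Algebra k A']

/-- The `k[t,t⁻¹]`-linear map induced by an algebra homomorphism. -/
def laurentMap (f : A →ₐ[k] A') : Laurent k A →ₗ[k] Laurent k A' where
  toFun x i j := redMap f j (x i j)
  map_add' _ _ := by ext; simp
  map_smul' _ _ := by ext; simp

theorem laurentMap_cycD (f : A →ₐ[k] A') (x : Laurent k A) :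
    laurentMap f (cycD k A x) = cycD k A' (laurentMap f x) := by
  ext i j
  cases j <;> simp [laurentMap, cycD, totalD, redMap_connesRed, redMap_bRed]

theorem laurentMap_heartD (f : A →ₐ[k] A') (x : Laurent k A) :
    laurentMap f (heartD k A x) = heartD k A' (laurentMap f x) := by
  ext i j
  cases j <;> simp [laurentMap, heartD, totalD, redMap_dRed, redMap_iDeltaRed]

theorem laurentMap_karoubiL (f : A →ₐ[k] A') (x : Laurent k A) :
    laurentMap f (karoubiL k A x) = karoubiL k A' (laurentMap f x) := by
  ext i j
  simp [laurentMap, karoubiL, redMap_karoubiRed]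

theorem laurentMap_plusPart (f : A →ₐ[k] A') :
    plusPart k A ≤ (plusPart k A').comap (laurentMap f) :=
  fun x hx i j h => by simp [laurentMap, hx i j h]

theorem laurentMap_nonnegPart (f : A →ₐ[k] A') :
    nonnegPart k A ≤ (nonnegPart k A').comap (laurentMap f) :=
  fun x hx i j h => by simp [laurentMap, hx i j h]

theorem laurentMap_degPart (f : A →ₐ[k] A') (m : ℤ) :
    degPart k A m ≤ (degPart k A' m).comap (laurentMap f) :=
  fun x hx i j h => by simp [laurentMap, hx i j h]

end Laurent

section Homology

variable {k : Type v} [Field k] {E : Type u} [AddCommGroup E] [Module k E]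

/-- The degree `m` cycles of a differential `D` of degree `1`, where `G m` is the degree `m` part. -/
def cycles (D : E →ₗ[k] E) (G : ℤ → Submodule k E) (m : ℤ) : Submodule k E :=
  LinearMap.ker D ⊓ G m

/-- The degree `m` boundaries. -/
def boundaries (D : E →ₗ[k] E) (G : ℤ → Submodule k E) (m : ℤ) : Submodule k E :=
  (G (m - 1)).map D

/-- The cohomology in degree `m`. -/
abbrev Cohomology (D : E →ₗ[k] E) (G : ℤ → Submodule k E) (m : ℤ) : Type u :=
  cycles D G m ⧸ (boundaries D G m).submoduleOf (cycles D G m)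

/-- The harmonic part `Ker (Id - κ)²`. -/
def harmonicPart (κ : E →ₗ[k] E) : Submodule k E :=
  LinearMap.ker ((LinearMap.id - κ) ∘ₗ (LinearMap.id - κ))

/-- The harmonic part of the cohomology in degree `m`: the classes of the harmonic cycles. -/
def harmonicCohomology (D κ : E →ₗ[k] E) (G : ℤ → Submodule k E) (m : ℤ) :
    Submodule k (Cohomology D G m) :=
  ((harmonicPart κ).submoduleOf (cycles D G m)).map
    ((boundaries D G m).submoduleOf (cycles D G m)).mkQ

variable {E' : Type u} [AddCommGroup E'] [Module k E']
  {D : E →ₗ[k] E} {G : ℤ → Submodule k E} {D' : E' →ₗ[k] E'} {G' : ℤ → Submodule k E'}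

theorem cycles_le (f : E →ₗ[k] E') (s : ℤ) (hD : ∀ x, f (D x) = D' (f x))
    (hG : ∀ m, G m ≤ (G' (m + s)).comap f) (m m' : ℤ) (hm : m' = m + s) :
    ∀ x ∈ cycles D G m, f x ∈ cycles D' G' m' := by
  subst hm
  intro x hx
  refine ⟨?_, hG m hx.2⟩
  have h : D x = 0 := hx.1
  change D' (f x) = 0
  rw [← hD, h, map_zero]

/-- The map on cohomology induced by a chain map `f` of degree `s`. -/
def cohomologyMap (f : E →ₗ[k] E') (s : ℤ) (hD : ∀ x, f (D x) = D' (f x))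
    (hG : ∀ m, G m ≤ (G' (m + s)).comap f) (m m' : ℤ) (hm : m' = m + s) :
    Cohomology D G m →ₗ[k] Cohomology D' G' m' :=
  Submodule.mapQ _ _ (f.restrict (cycles_le f s hD hG m m' hm)) (by
    rintro ⟨x, hx⟩ ⟨y, hy, hyx⟩
    refine ⟨f y, ?_, ?_⟩
    · have h : m' - 1 = m - 1 + s := by omega
      rw [h]
      exact hG (m - 1) hy
    · rw [← hD, hyx]
      rfl)

theorem cohomologyMap_harmonic (f : E →ₗ[k] E') (s : ℤ) (hD : ∀ x, f (D x) = D' (f x))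
    (hG : ∀ m, G m ≤ (G' (m + s)).comap f) (m m' : ℤ) (hm : m' = m + s)
    {κ : E →ₗ[k] E} {κ' : E' →ₗ[k] E'} (hκ : ∀ x, f (κ x) = κ' (f x)) :
    ∀ x ∈ harmonicCohomology D κ G m,
      cohomologyMap f s hD hG m m' hm x ∈ harmonicCohomology D' κ' G' m' := by
  rintro _ ⟨⟨x, hx⟩, hxP, rfl⟩
  refine ⟨⟨f x, cycles_le f s hD hG m m' hm x hx⟩, ?_, rfl⟩
  have h : x - κ x - κ (x - κ x) = 0 := hxP
  change f x - κ' (f x) - κ' (f x - κ' (f x)) = 0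
  have h' := congrArg f h
  simpa [hκ] using h'

/-- The restriction of the induced map to the harmonic parts of the cohomology, for `f`
commuting with the operators `κ`. -/
def harmonicMap (f : E →ₗ[k] E') (s : ℤ) (hD : ∀ x, f (D x) = D' (f x))
    (hG : ∀ m, G m ≤ (G' (m + s)).comap f) (m m' : ℤ) (hm : m' = m + s)
    {κ : E →ₗ[k] E} {κ' : E' →ₗ[k] E'} (hκ : ∀ x, f (κ x) = κ' (f x)) :
    harmonicCohomology D κ G m →ₗ[k] harmonicCohomology D' κ' G' m' :=
  (cohomologyMap f s hD hG m m' hm).restrict (cohomologyMap_harmonic f s hD hG m m' hm hκ)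

end Homology

section Theories

variable (k : Type v) [Field k] (A : Type u) [Ring A] [Algebra k A]

/-- The quotient of the module of Laurent families by `plusPart`. -/
abbrev LQuot : Type u := Laurent k A ⧸ plusPart k A

/-- The degree `m` part of the quotient. -/
def quotDeg (m : ℤ) : Submodule k (LQuot k A) := (degPart k A m).map (plusPart k A).mkQ

/-- The degree `m` part of `nonnegPart`. -/
def nonnegDeg (m : ℤ) : Submodule k (Laurent k A) := degPart k A m ⊓ nonnegPart k A

/-- `B + t b` on the quotient. -/
def cycDQuot : LQuot k A →ₗ[k] LQuot k A :=
  (plusPart k A).mapQ (plusPart k A) (cycD k A) (totalD_plusPart _ _)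

/-- `d + t ı_Δ` on the quotient. -/
def heartDQuot : LQuot k A →ₗ[k] LQuot k A :=
  (plusPart k A).mapQ (plusPart k A) (heartD k A) (totalD_plusPart _ _)

/-- The Karoubi operator on the quotient. -/
def karoubiQuot : LQuot k A →ₗ[k] LQuot k A :=
  (plusPart k A).mapQ (plusPart k A) (karoubiL k A) karoubiL_plusPart

/-- Multiplication by `t` on the quotient. -/
def tQuot : LQuot k A →ₗ[k] LQuot k A :=
  (plusPart k A).mapQ (plusPart k A) (tMul k A) tMul_plusPart

/-- Reduced cyclic homology `HC_n(A)`. -/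
abbrev HC (n : ℤ) : Type u := Cohomology (cycDQuot k A) (quotDeg k A) (-n)

/-- Reduced negative cyclic homology `HC^-_n(A)`. -/
abbrev HCneg (n : ℤ) : Type u := Cohomology (cycD k A) (nonnegDeg k A) (-n)

/-- The homology `♥HC_n(A)`, with `d + t ı_Δ` in place of `B + t b`. -/
abbrev HeartHC (n : ℤ) : Type u := Cohomology (heartDQuot k A) (quotDeg k A) (-n)

/-- The homology `♥HC^-_n(A)`, with `d + t ı_Δ` in place of `B + t b`. -/
abbrev HeartHCneg (n : ℤ) : Type u := Cohomology (heartD k A) (nonnegDeg k A) (-n)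

/-- The harmonic part `P(♥HC_n(A))`. -/
abbrev PHeartHC (n : ℤ) : Submodule k (HeartHC k A n) :=
  harmonicCohomology (heartDQuot k A) (karoubiQuot k A) (quotDeg k A) (-n)

/-- The harmonic part `P(♥HC^-_n(A))`. -/
abbrev PHeartHCneg (n : ℤ) : Submodule k (HeartHCneg k A n) :=
  harmonicCohomology (heartD k A) (karoubiL k A) (nonnegDeg k A) (-n)

variable {k A}

theorem cycDQuot_t (x : LQuot k A) : tQuot k A (cycDQuot k A x) = cycDQuot k A (tQuot k A x) := by
  obtain ⟨x, rfl⟩ := Submodule.mkQ_surjective _ x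
  exact congrArg (plusPart k A).mkQ (totalD_tMul _ _ x).symm

theorem heartDQuot_t (x : LQuot k A) :
    tQuot k A (heartDQuot k A x) = heartDQuot k A (tQuot k A x) := by
  obtain ⟨x, rfl⟩ := Submodule.mkQ_surjective _ x
  exact congrArg (plusPart k A).mkQ (totalD_tMul _ _ x).symm

theorem karoubiQuot_t (x : LQuot k A) :
    tQuot k A (karoubiQuot k A x) = karoubiQuot k A (tQuot k A x) := by
  obtain ⟨x, rfl⟩ := Submodule.mkQ_surjective _ x
  rfl

theorem quotDeg_t (m : ℤ) : quotDeg k A m ≤ (quotDeg k A (m + 2)).comap (tQuot k A) := by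
  rintro _ ⟨x, hx, rfl⟩
  exact ⟨tMul k A x, tMul_degPart m hx, rfl⟩

theorem nonnegDeg_t (m : ℤ) : nonnegDeg k A m ≤ (nonnegDeg k A (m + 2)).comap (tMul k A) :=
  fun _ hx => ⟨tMul_degPart m hx.1, tMul_nonnegPart hx.2⟩

/-- The action of `t` on `HC`, of homological degree `-2`. -/
def HC.t (n : ℤ) : HC k A n →ₗ[k] HC k A (n - 2) :=
  cohomologyMap (tQuot k A) 2 cycDQuot_t quotDeg_t (-n) (-(n - 2)) (by ring)

/-- The action of `t` on `HC^-`. -/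
def HCneg.t (n : ℤ) : HCneg k A n →ₗ[k] HCneg k A (n - 2) :=
  cohomologyMap (tMul k A) 2 (fun x => (totalD_tMul _ _ x).symm) nonnegDeg_t
    (-n) (-(n - 2)) (by ring)

/-- The action of `t` on `P(♥HC)`. -/
def PHeartHC.t (n : ℤ) : PHeartHC k A n →ₗ[k] PHeartHC k A (n - 2) :=
  harmonicMap (tQuot k A) 2 heartDQuot_t quotDeg_t (-n) (-(n - 2)) (by ring) karoubiQuot_t

/-- The action of `t` on `P(♥HC^-)`. -/
def PHeartHCneg.t (n : ℤ) : PHeartHCneg k A n →ₗ[k] PHeartHCneg k A (n - 2) :=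
  harmonicMap (tMul k A) 2 (fun x => (totalD_tMul _ _ x).symm) nonnegDeg_t
    (-n) (-(n - 2)) (by ring) (fun x => (karoubiL_tMul x).symm)

variable {A' : Type u} [Ring A'] [Algebra k A'] (f : A →ₐ[k] A')

/-- The map on the quotients induced by an algebra homomorphism. -/
def quotMap : LQuot k A →ₗ[k] LQuot k A' :=
  (plusPart k A).mapQ (plusPart k A') (laurentMap f) (laurentMap_plusPart f)

theorem quotMap_cycDQuot (x : LQuot k A) :
    quotMap f (cycDQuot k A x) = cycDQuot k A' (quotMap f x) := by
  obtain ⟨x, rfl⟩ := Submodule.mkQ_surjective _ x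
  exact congrArg (plusPart k A').mkQ (laurentMap_cycD f x)

theorem quotMap_heartDQuot (x : LQuot k A) :
    quotMap f (heartDQuot k A x) = heartDQuot k A' (quotMap f x) := by
  obtain ⟨x, rfl⟩ := Submodule.mkQ_surjective _ x
  exact congrArg (plusPart k A').mkQ (laurentMap_heartD f x)

theorem quotMap_karoubiQuot (x : LQuot k A) :
    quotMap f (karoubiQuot k A x) = karoubiQuot k A' (quotMap f x) := by
  obtain ⟨x, rfl⟩ := Submodule.mkQ_surjective _ x
  exact congrArg (plusPart k A').mkQ (laurentMap_karoubiL f x)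

theorem quotMap_quotDeg (m : ℤ) : quotDeg k A m ≤ (quotDeg k A' (m + 0)).comap (quotMap f) := by
  rw [add_zero]
  rintro _ ⟨x, hx, rfl⟩
  exact ⟨laurentMap f x, laurentMap_degPart f m hx, rfl⟩

theorem laurentMap_nonnegDeg (m : ℤ) :
    nonnegDeg k A m ≤ (nonnegDeg k A' (m + 0)).comap (laurentMap f) := by
  rw [add_zero]
  exact fun _ hx => ⟨laurentMap_degPart f m hx.1, laurentMap_nonnegPart f hx.2⟩

/-- The map `HC_n(A) → HC_n(A')` induced by an algebra homomorphism `A → A'`. -/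
def HC.map (n : ℤ) : HC k A n →ₗ[k] HC k A' n :=
  cohomologyMap (quotMap f) 0 (quotMap_cycDQuot f) (quotMap_quotDeg f) (-n) (-n) (by ring)

/-- The map `HC^-_n(A) → HC^-_n(A')` induced by an algebra homomorphism `A → A'`. -/
def HCneg.map (n : ℤ) : HCneg k A n →ₗ[k] HCneg k A' n :=
  cohomologyMap (laurentMap f) 0 (laurentMap_cycD f) (laurentMap_nonnegDeg f) (-n) (-n) (by ring)

/-- The map `P(♥HC_n(A)) → P(♥HC_n(A'))` induced by an algebra homomorphism `A → A'`. -/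
def PHeartHC.map (n : ℤ) : PHeartHC k A n →ₗ[k] PHeartHC k A' n :=
  harmonicMap (quotMap f) 0 (quotMap_heartDQuot f) (quotMap_quotDeg f) (-n) (-n) (by ring)
    (quotMap_karoubiQuot f)

/-- The map `P(♥HC^-_n(A)) → P(♥HC^-_n(A'))` induced by an algebra homomorphism `A → A'`. -/
def PHeartHCneg.map (n : ℤ) : PHeartHCneg k A n →ₗ[k] PHeartHCneg k A' n :=
  harmonicMap (laurentMap f) 0 (laurentMap_heartD f) (laurentMap_nonnegDeg f) (-n) (-n) (by ring)
    (laurentMap_karoubiL f)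

end Theories

end

end NCForms

/-! The Karoubi operator satisfies `b d + d b = 1 - κ`, commutes with `b` and `d`, and on `n`-forms
with `n > 0` is killed by `(κ^n - 1)(κ^(n+1) - 1)`. In characteristic `0` the root `1` of this
polynomial has multiplicity exactly two, so reduced forms split as `Ker (1 - κ)² ⊕ Im (1 - κ)²`. Let
`P` be the projection onto the first (harmonic) summand, and let `G`, the Green operator, invert `1
- κ` on the second and vanish on the first.

The complement of the harmonic part is contractible for `B + t b`. Since `B d = d B = 0`, the
operator `h = t⁻¹ G d` satisfies `(B + t b) h + h (B + t b) = b G d + G d b = G (1 - κ) = 1 - P`.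
Hence `HC` and `HC⁻` are computed by the harmonic subcomplexes.

On harmonic forms the two differentials agree up to scalars. By definition `B` is a sum of terms
`κ^j d`, and the contraction turns out to be `ı_Δ = -∑ b κ^j` (`contract_eq`, `iDelta_eq`). A
harmonic vector fixed by a positive power of `κ` is fixed by `κ`, which applies to `d P x` and `b P
x`. So on harmonic forms `B = (n+1) d` on degree `n`, and `ı_Δ = -(n+1) b` on degree `n+1`
(`connesRed_harmRed`, `iDeltaRed_harmRed`). Rescaling `j`-forms by `(-1)^⌊j/2⌋ j!` intertwines `d +
t ı_Δ` with `B + t b`, up to a sign depending only on the total degree.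

All these operators preserve `P` and the filtrations, and the rescaling commutes with `t` and with
algebra maps. The abstract argument is in `HarmonicComparison`, its instance in `laurentComparison`.
-/

namespace NCForms

noncomputable section

/-! ### Bimodule structure and Leibniz rules on noncommutative forms. -/

section FormAlgebra

variable {k : Type v} [Field k] {A : Type u} [Ring A] [Algebra k A]

theorem lmul_lmul (a c : A) (n : ℕ) (ω : Om k A n) :
    lmul n a (lmul n c ω) = lmul n (a * c) ω := by
  refine om_induction (P := fun n ω => lmul n a (lmul n c ω) = lmul n (a * c) ω)
    ?_ ?_ ?_ ?_ n ω
  · intro x; simp [lmul_zero_apply, mul_assoc]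
  · intro n ω η h h'; simp [h, h']
  · intro n; simp
  · intro n ω x h; simp [lmul_mulD, h]

theorem lmul_rmul (a : A) (n : ℕ) (ω : Om k A n) :
    ∀ c : A, lmul n a (rmul n ω c) = rmul n (lmul n a ω) c := by
  refine om_induction (P := fun n ω => ∀ c : A, lmul n a (rmul n ω c) = rmul n (lmul n a ω) c)
    ?_ ?_ ?_ ?_ n ω
  · intro x c; simp [lmul_zero_apply, rmul_zero_apply, mul_assoc]
  · intro n ω η h h' c; simp [h, h']
  · intro n; simp
  · intro n ω x h c; simp [lmul_mulD, rmul_mulD, h]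

theorem rmul_rmul (n : ℕ) (ω : Om k A n) :
    ∀ a c : A, rmul n (rmul n ω a) c = rmul n ω (a * c) := by
  refine om_induction (P := fun n ω => ∀ a c : A, rmul n (rmul n ω a) c = rmul n ω (a * c))
    ?_ ?_ ?_ ?_ n ω
  · intro x a c; simp [rmul_zero_apply, mul_assoc]
  · intro n ω η h h' a c; simp [h, h']
  · intro n; simp
  · intro n ω x h a c
    simp only [rmul_mulD, map_sub, LinearMap.sub_apply, h, mul_assoc]
    abel

theorem d_zero_apply (a : A) : d 0 (zeroEquiv k A a) = mulD 0 one a := by simp [d]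

@[simp]
theorem d_one : d 0 (one : Om k A 0) = 0 := by simp [one, d_zero_apply]

theorem d_d (n : ℕ) (ω : Om k A n) : d (n + 1) (d n ω) = 0 := by
  refine om_induction (P := fun n ω => d (n + 1) (d n ω) = 0) ?_ ?_ ?_ ?_ n ω
  · intro x; simp [d_zero_apply, d_mulD]
  · intro n ω η h h'; simp [h, h']
  · intro n; simp
  · intro n ω x h; simp [d_mulD, h]

theorem d_rmul (n : ℕ) (ω : Om k A n) :
    ∀ c : A, d n (rmul n ω c) = rmul (n + 1) (d n ω) c + (-1 : k) ^ n • mulD n ω c := by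
  refine om_induction (P := fun n ω => ∀ c : A,
    d n (rmul n ω c) = rmul (n + 1) (d n ω) c + (-1 : k) ^ n • mulD n ω c) ?_ ?_ ?_ ?_ n ω
  · intro x c
    have h : rmul 0 (one : Om k A 0) x = zeroEquiv k A x := by simp [one, rmul_zero_apply]
    simp [rmul_zero_apply, d_zero_apply, rmul_mulD, h]
  · intro n ω η h h' c; simp [h, h']; abel
  · intro n; simp
  · intro n ω x h c
    simp only [rmul_mulD, map_sub, h, d_mulD, map_add, LinearMap.add_apply,
      map_smul, LinearMap.smul_apply, pow_succ]
    module

theorem dmul_apply (n : ℕ) (a : A) (ω : Om k A n) :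
    dmul n a ω = d n (lmul n a ω) - lmul (n + 1) a (d n ω) := by simp [dmul]

theorem dmul_zero_apply (a c : A) : dmul 0 a (zeroEquiv k A c) =
    mulD 0 one (a * c) - mulD 0 (zeroEquiv k A a) c := by
  simp [dmul_apply, lmul_zero_apply, d_zero_apply, lmul_mulD, one]

theorem dmul_one_form (a : A) : dmul 0 a (one : Om k A 0) = mulD 0 one a := by
  simp [one, dmul_zero_apply]

theorem dmul_mulD (n : ℕ) (a : A) (ω : Om k A n) (c : A) :
    dmul (n + 1) a (mulD n ω c) = mulD (n + 1) (dmul n a ω) c := by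
  simp [dmul_apply, lmul_mulD, d_mulD]

theorem dmul_rmul (n : ℕ) (a : A) (ω : Om k A n) (c : A) :
    dmul n a (rmul n ω c) = rmul (n + 1) (dmul n a ω) c := by
  simp only [dmul_apply, lmul_rmul, d_rmul, map_add, map_sub, map_smul, LinearMap.sub_apply,
    lmul_mulD]
  abel

/-! ### Relations between `b`, `d` and `κ`. -/

theorem b_b (n : ℕ) (ω : Om k A (n + 2)) : b n (b (n + 1) ω) = 0 := by
  refine LinearMap.congr_fun (f := b n ∘ₗ b (n + 1)) (g := 0) (hom_ext fun ω a => ?_) ω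
  refine LinearMap.congr_fun (f := b n ∘ₗ b (n + 1) ∘ₗ (mulD (n + 1)).flip a) (g := 0)
    (hom_ext fun η c => ?_) ω
  simp only [LinearMap.comp_apply, LinearMap.flip_apply, b_mulD, rmul_mulD, lmul_mulD, map_smul,
    map_sub, LinearMap.zero_apply, lmul_rmul, rmul_rmul, lmul_lmul]
  module

/-- The homotopy identity `b d + d b = 1 - κ`. -/
theorem b_d_add_d_b (n : ℕ) (ω : Om k A (n + 1)) :
    b (n + 1) (d (n + 1) ω) + d n (b n ω) = ω - karoubi (n + 1) ω := by
  refine LinearMap.congr_fun (f := b (n + 1) ∘ₗ d (n + 1) + d n ∘ₗ b n)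
    (g := LinearMap.id - karoubi (n + 1)) (hom_ext fun ω a => ?_) ω
  simp only [LinearMap.add_apply, LinearMap.comp_apply, LinearMap.sub_apply, LinearMap.id_apply,
    d_mulD, b_mulD, karoubi_mulD, map_smul, map_sub, d_rmul, dmul_apply, smul_sub, smul_add,
    smul_smul, ← pow_add, ← two_mul, pow_succ]
  simp only [pow_mul, neg_one_sq, one_pow]
  module

theorem b_d_zero (ω : Om k A 0) : b 0 (d 0 ω) = 0 := by
  obtain ⟨a, rfl⟩ := (zeroEquiv k A).surjective ω
  simp [d_zero_apply, b_mulD, one, lmul_zero_apply, rmul_zero_apply]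

@[simp]
theorem karoubi_zero (ω : Om k A 0) : karoubi 0 ω = ω := rfl

/-- Because `d² = 0`, the homotopy identity gives `(1 - κ) d = d b d = d (1 - κ)`. The commutation
with `b` below is the same argument with `b d b`. -/
theorem karoubi_d (n : ℕ) (ω : Om k A n) :
    karoubi (n + 1) (d n ω) = d n (karoubi n ω) := by
  have h := b_d_add_d_b n (d n ω)
  rw [d_d, map_zero, zero_add] at h
  cases n with
  | zero =>
    rw [b_d_zero, map_zero] at h
    exact (sub_eq_zero.mp h.symm).symm
  | succ n =>
    have h' := congrArg (d (n + 1)) (b_d_add_d_b n ω)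
    rw [map_add, d_d, add_zero, map_sub, h] at h'
    exact sub_right_injective h'

theorem karoubi_b (n : ℕ) (ω : Om k A (n + 1)) :
    karoubi n (b n ω) = b n (karoubi (n + 1) ω) := by
  have h := congrArg (b n) (b_d_add_d_b n ω)
  rw [map_add, b_b, zero_add, map_sub] at h
  cases n with
  | zero =>
    rw [b_d_zero] at h
    exact sub_eq_zero.mp h.symm
  | succ n =>
    have h' := b_d_add_d_b n (b (n + 1) ω)
    rw [b_b, map_zero, add_zero, h] at h'
    exact (sub_right_injective h').symm

theorem karoubi_pow_d (n j : ℕ) (ω : Om k A n) :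
    ((karoubi (n + 1) : Module.End k (Om k A (n + 1))) ^ j) (d n ω) =
      d n (((karoubi n : Module.End k (Om k A n)) ^ j) ω) := by
  induction j generalizing ω with
  | zero => rfl
  | succ j ih => simp only [pow_succ, Module.End.mul_apply, karoubi_d, ih]

theorem karoubi_pow_b (n j : ℕ) (ω : Om k A (n + 1)) :
    ((karoubi n : Module.End k (Om k A n)) ^ j) (b n ω) =
      b n (((karoubi (n + 1) : Module.End k (Om k A (n + 1))) ^ j) ω) := by
  induction j generalizing ω with
  | zero => rfl
  | succ j ih => simp only [pow_succ, Module.End.mul_apply, karoubi_b, ih]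

/-! ### Products of forms and cyclic rotation by powers of `κ`. -/

section Cast

@[simp]
theorem castOm_rfl {i : ℕ} (h : i = i) (ω : Om k A i) : castOm h ω = ω := rfl

@[simp]
theorem castOm_castOm {i j l : ℕ} (h : i = j) (h' : j = l) (ω : Om k A i) :
    castOm h' (castOm h ω) = castOm (h.trans h') ω := by
  subst h; rfl

theorem castOm_mulD {i j : ℕ} (h : i = j) (ω : Om k A i) (a : A) :
    mulD j (castOm h ω) a = castOm (congrArg (· + 1) h) (mulD i ω a) := by
  subst h; rfl

theorem castOm_dmul {i j : ℕ} (h : i = j) (ω : Om k A i) (a : A) :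
    dmul j a (castOm h ω) = castOm (congrArg (· + 1) h) (dmul i a ω) := by
  subst h; rfl

theorem castOm_karoubi_pow {i j : ℕ} (h : i = j) (l : ℕ) (ω : Om k A i) :
    ((karoubi j : Module.End k (Om k A j)) ^ l) (castOm h ω) =
      castOm h (((karoubi i : Module.End k (Om k A i)) ^ l) ω) := by
  subst h; rfl

end Cast

@[simp]
theorem mul_one_form (p : ℕ) (ω : Om k A p) : mul p 0 ω one = ω := by
  simp [one, mul_zero_apply]

theorem one_form_mul (n : ℕ) (ω : Om k A n) :
    mul 0 n one ω = castOm (zero_add n).symm ω := by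
  refine om_induction (P := fun n ω => mul 0 n one ω = castOm (zero_add n).symm ω)
    ?_ ?_ ?_ ?_ n ω
  · intro x; simp [mul_zero_apply, one, rmul_zero_apply]
  · intro n ω η h h'; simp [h, h']
  · intro n; simp
  · intro n ω x h
    rw [mul_mulD, h, castOm_mulD]

theorem mul_zeroEquiv_left (a : A) (n : ℕ) (ω : Om k A n) :
    mul 0 n (zeroEquiv k A a) ω = castOm (zero_add n).symm (lmul n a ω) := by
  refine om_induction (P := fun n ω =>
    mul 0 n (zeroEquiv k A a) ω = castOm (zero_add n).symm (lmul n a ω)) ?_ ?_ ?_ ?_ n ω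
  · intro x; simp [mul_zero_apply, rmul_zero_apply, lmul_zero_apply]
  · intro n ω η h h'; simp [h, h']
  · intro n; simp
  · intro n ω x h
    rw [mul_mulD, h, castOm_mulD, lmul_mulD]

theorem dmul_mul (a : A) (p : ℕ) (η : Om k A p) (n : ℕ) (ω : Om k A n) :
    mul (p + 1) n (dmul p a η) ω =
      castOm (add_right_comm p n 1) (dmul (p + n) a (mul p n η ω)) := by
  refine om_induction (P := fun n ω => mul (p + 1) n (dmul p a η) ω =
      castOm (add_right_comm p n 1) (dmul (p + n) a (mul p n η ω))) ?_ ?_ ?_ ?_ n ω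
  · intro x
    exact (mul_zero_apply _ _ _).trans (by
      rw [mul_zero_apply]; exact (dmul_rmul p a η x).symm)
  · intro n ω η h h'; simp [h, h']
  · intro n; simp
  · intro n ω x h
    rw [mul_mulD, h, castOm_mulD, mul_mulD]
    exact congrArg _ (dmul_mulD (p + n) a _ x).symm

/-- The case of associativity that lets a factor `da` pass from the end of one form to the front of
the next, as rotation requires. -/
theorem mulD_mul (p : ℕ) (ζ : Om k A p) (a : A) (n : ℕ) (ω : Om k A n) :
    mul (p + 1) n (mulD p ζ a) ω =
      castOm (add_right_comm p n 1) (mul p (n + 1) ζ (dmul n a ω)) := by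
  refine om_induction (P := fun n ω => mul (p + 1) n (mulD p ζ a) ω =
      castOm (add_right_comm p n 1) (mul p (n + 1) ζ (dmul n a ω))) ?_ ?_ ?_ ?_ n ω
  · intro x
    rw [mul_zero_apply, rmul_mulD, dmul_zero_apply, map_sub, mul_mulD, mul_mulD, mul_one_form,
      mul_zero_apply]
    rfl
  · intro n ω η h h'; simp [h, h']
  · intro n; simp
  · intro n ω x h
    rw [mul_mulD, h, castOm_mulD, dmul_mulD, mul_mulD]
    rfl

/-- The Karoubi operator rotates exact forms: `κ^{q+1} (ω dη) = (-1)^{|ω|(q+1)} dη ω`. -/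
theorem karoubi_pow_mul_d (q : ℕ) (η : Om k A q) : ∀ (p : ℕ) (ω : Om k A p),
    ((karoubi (p + (q + 1)) : Module.End k (Om k A (p + (q + 1)))) ^ (q + 1))
        (mul p (q + 1) ω (d q η)) =
      (-1 : k) ^ (p * (q + 1)) • castOm (add_comm _ _) (mul (q + 1) p (d q η) ω) := by
  refine om_induction (P := fun q η => ∀ (p : ℕ) (ω : Om k A p),
    ((karoubi (p + (q + 1)) : Module.End k (Om k A (p + (q + 1)))) ^ (q + 1))
        (mul p (q + 1) ω (d q η)) =
      (-1 : k) ^ (p * (q + 1)) • castOm (add_comm _ _) (mul (q + 1) p (d q η) ω))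
    ?_ ?_ ?_ ?_ q η
  · intro x p ω
    rw [d_zero_apply, mul_mulD, mul_one_form, mulD_mul, one_form_mul]
    have := karoubi_mulD p ω x
    simpa using this
  · intro n ω η h h' p ζ; simp [h, h']
  · intro n p ω; simp
  · intro q η x h p ω
    -- One application of `κ` moves the last factor `dx` to the front. The remaining rotation is the
    -- induction hypothesis with `dx ω` in place of `ω`.
    have h1 := h (p + 1) (dmul p x ω)
    rw [dmul_mul] at h1
    rw [d_mulD, mul_mulD, pow_succ, Module.End.mul_apply, mulD_mul]
    have h2 := karoubi_mulD (p + (q + 1)) (mul p (q + 1) ω (d q η)) x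
    refine (congrArg _ h2).trans ?_
    rw [map_smul]
    rw [castOm_karoubi_pow] at h1
    have h3 := congrArg (castOm (k := k) (A := A) (add_right_comm p (q + 1) 1).symm) h1
    simp only [castOm_castOm, castOm_rfl, map_smul] at h3
    refine (congrArg _ h3).trans ?_
    rw [smul_smul, castOm_castOm]
    congr 1
    rw [← pow_add]
    -- The sign of the single step times the inductive sign differs from the wanted one by an even
    -- power of `-1`.
    rw [show p + (q + 1) + (p + 1) * (q + 1) = p * (q + 1 + 1) + 2 * (q + 1) by ring, pow_add,
      pow_mul (-1 : k) 2]
    simp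

/-- The rotation formula with the unit as the other factor: all `n + 1` exact factors return to
their places. -/
theorem karoubi_pow_succ_d (n : ℕ) (ω : Om k A n) :
    ((karoubi (n + 1) : Module.End k (Om k A (n + 1))) ^ (n + 1)) (d n ω) = d n ω := by
  have h := karoubi_pow_mul_d n ω 0 one
  rw [one_form_mul, castOm_karoubi_pow, mul_one_form, zero_mul, pow_zero, one_smul] at h
  have h3 := congrArg (castOm (k := k) (A := A) (zero_add (n + 1))) h
  simpa only [castOm_castOm, castOm_rfl] using h3

/-- Linear maps on forms of positive degree are determined by their values on the forms `a dη`. -/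
theorem hom_ext_lmul_d {M : Type*} [AddCommGroup M] [Module k M] : (n : ℕ) →
    {f g : Om k A (n + 1) →ₗ[k] M} →
    (∀ a η, f (lmul (n + 1) a (d n η)) = g (lmul (n + 1) a (d n η))) → f = g
  | 0, f, g, h => hom_ext fun ω a => by
    obtain ⟨c, rfl⟩ := (zeroEquiv k A).surjective ω
    have := h c (zeroEquiv k A a)
    rwa [d_zero_apply, lmul_mulD, one, lmul_zero_apply, mul_one] at this
  | n + 1, f, g, h => hom_ext fun ω a =>
    LinearMap.congr_fun (hom_ext_lmul_d n (f := f ∘ₗ (mulD (n + 1)).flip a)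
      (g := g ∘ₗ (mulD (n + 1)).flip a) fun c η => by
        have := h c (mulD n η a)
        rwa [d_mulD, lmul_mulD] at this) ω

/-- On `a dη` of degree `N > 0`, the power `κ^N` gives `dη a`, while the same power sends `d (a dη)
= da dη` to `± dη da`. Applying `b` to the latter yields the difference `dη a - a dη`. -/
theorem karoubi_pow_eq : (n : ℕ) → (ω : Om k A n) →
    ((karoubi n : Module.End k (Om k A n)) ^ n) ω =
      ω + b n (((karoubi (n + 1) : Module.End k (Om k A (n + 1))) ^ n) (d n ω))
  | 0, ω => by simp [b_d_zero]
  | n + 1, ω => by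
    refine LinearMap.congr_fun (f := (karoubi (n + 1) : Module.End k (Om k A (n + 1))) ^ (n + 1))
      (g := LinearMap.id + b (n + 1) ∘ₗ
        ((karoubi (n + 2) : Module.End k (Om k A (n + 2))) ^ (n + 1)) ∘ₗ d (n + 1))
      (hom_ext_lmul_d n fun a η => ?_) ω
    have h0 := karoubi_pow_mul_d n η 0 (zeroEquiv k A a)
    rw [mul_zeroEquiv_left, castOm_karoubi_pow, mul_zero_apply, zero_mul, pow_zero, one_smul] at h0
    have h0' := congrArg (castOm (k := k) (A := A) (zero_add (n + 1))) h0
    simp only [castOm_castOm, castOm_rfl] at h0'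
    have h1 := karoubi_pow_mul_d n η 1 (dmul 0 a one)
    rw [dmul_mul, one_form_mul, castOm_karoubi_pow, castOm_dmul, castOm_karoubi_pow, dmul_one_form,
      mul_mulD, mul_one_form, one_mul] at h1
    have h1' := congrArg (castOm (k := k) (A := A) (add_comm 1 (n + 1))) h1
    simp only [castOm_castOm, castOm_rfl, map_smul] at h1'
    have h2 : d (n + 1) (lmul (n + 1) a (d n η)) = dmul (n + 1) a (d n η) := by
      simp [dmul_apply, d_d]
    simp only [LinearMap.add_apply, LinearMap.id_apply, LinearMap.comp_apply]
    rw [h2, h0']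
    refine Eq.trans ?_ (congrArg (fun x => _ + b (n + 1) x) h1'.symm)
    simp only [map_smul]
    rw [b_mulD, smul_smul, ← mul_pow]
    simp

/-- Applying `κ` once more to `karoubi_pow_eq` completes the rotation of the exact form `dω`,
leaving `κ ω + b d ω`, which is `ω - d b ω` by the homotopy identity. -/
theorem karoubi_pow_succ (n : ℕ) (ω : Om k A (n + 1)) :
    ((karoubi (n + 1) : Module.End k (Om k A (n + 1))) ^ (n + 2)) ω = ω - d n (b n ω) := by
  rw [pow_succ', Module.End.mul_apply, karoubi_pow_eq, map_add, karoubi_b, ← Module.End.mul_apply,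
    ← pow_succ', karoubi_pow_succ_d, eq_sub_iff_add_eq, add_assoc, b_d_add_d_b]
  abel

theorem karoubi_pow_succ_b (n : ℕ) (ω : Om k A (n + 1)) :
    ((karoubi n : Module.End k (Om k A n)) ^ (n + 1)) (b n ω) = b n ω := by
  cases n with
  | zero => rfl
  | succ n => rw [karoubi_pow_succ, b_b, map_zero, sub_zero]

/-- The right factor is `-d b` and the left one is `b κ^(n+1) d`, so `d² = 0` kills the product. -/
theorem karoubi_pow_sub_one (n : ℕ) (ω : Om k A (n + 1)) :
    (((karoubi (n + 1) : Module.End k (Om k A (n + 1))) ^ (n + 1) - 1) *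
      ((karoubi (n + 1) : Module.End k (Om k A (n + 1))) ^ (n + 2) - 1)) ω = 0 := by
  simp only [Module.End.mul_apply, LinearMap.sub_apply, karoubi_pow_succ, Module.End.one_apply]
  rw [karoubi_pow_eq]
  simp [d_d]

/-- The commutator in each summand is a Hochschild boundary up to sign, and passing to the next
summand rotates `η ω` by `κ`. In the induction on `n`, the `j = 0` term is the commutator with the
last factor, and the other terms are the contraction with that factor moved to the front of `η`. -/
theorem contract_eq (n : ℕ) : ∀ (p N : ℕ) (h : n + p = N + 1) (ω : Om k A n) (η : Om k A p),
    contract n p N h ω η = -(-1 : k) ^ (n * p) • ∑ j ∈ Finset.range n,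
      b N (((karoubi (N + 1) : Module.End k (Om k A (N + 1))) ^ j)
        (castOm ((add_comm p n).trans h) (mul p n η ω))) := by
  induction n with
  | zero => intro p N h ω η; simp [contract]
  | succ n ih =>
    intro p N h ω η
    refine LinearMap.congr_fun (f := (contract (n + 1) p N h).flip η)
      (g := -(-1 : k) ^ ((n + 1) * p) • ∑ j ∈ Finset.range (n + 1),
        b N ∘ₗ ((karoubi (N + 1) : Module.End k (Om k A (N + 1))) ^ j) ∘ₗ
          castOm ((add_comm p (n + 1)).trans h) ∘ₗ mul p (n + 1) η) (hom_ext fun ω a => ?_) ω |>.trans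
      (by simp)
    obtain rfl : N = p + n := by omega
    simp only [LinearMap.flip_apply, LinearMap.smul_apply, LinearMap.sum_apply,
      LinearMap.comp_apply]
    rw [contract_mulD, ih, Finset.sum_range_succ', mul_mulD, dmul_mul]
    simp only [castOm_castOm, castOm_rfl, pow_zero, Module.End.one_apply, pow_succ,
      Module.End.mul_apply]
    have hκ := karoubi_mulD (p + n) (mul p n η ω) a
    have hb := b_mulD (p + n) (mul p n η ω) a
    erw [hκ, hb]
    simp only [map_smul, ← Finset.smul_sum, smul_add, smul_smul]
    have hs : (-1 : k) ^ ((n + 1) * p) * (-1 : k) ^ (p + n) = (-1 : k) ^ (n * (p + 1)) := by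
      rw [← pow_add, show (n + 1) * p + (p + n) = n * (p + 1) + 2 * p by ring, pow_add,
        pow_mul (-1 : k) 2]
      simp
    rw [neg_mul, hs]
    module

theorem iDelta_eq (n : ℕ) (ω : Om k A (n + 1)) :
    iDelta n ω = -∑ j ∈ Finset.range (n + 1),
      b n (((karoubi (n + 1) : Module.End k (Om k A (n + 1))) ^ j) ω) := by
  simp [iDelta, contract_eq, one_form_mul]

end FormAlgebra

/-! ### Linear algebra of an operator `κ` near its eigenvalue `1`. -/

section HarmonicProjection

variable {k : Type*} [Field k] {V W : Type*} [AddCommGroup V] [Module k V] [AddCommGroup W]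
  [Module k W]

/-- The projection `1 - u (1 - κ)²` onto the harmonic part, where `u` inverts `(1 - κ)²` on the
image of `(1 - κ)²`. -/
def harmonicProj (κ u : Module.End k V) : Module.End k V := 1 - u * (1 - κ) ^ 2

/-- The Green operator of `1 - κ`: it vanishes on the harmonic part, and inverts `1 - κ` on the
complement. -/
def greenOp (κ u : Module.End k V) : Module.End k V := u * (1 - κ) * (1 - harmonicProj κ u)

variable {κ u : Module.End k V} {κ' u' : Module.End k W}

theorem sq_mul_harmonicProj (hc : Commute u κ) (hu : u * (1 - κ) ^ 4 = (1 - κ) ^ 2) :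
    (1 - κ) ^ 2 * harmonicProj κ u = 0 := by
  have hcN : Commute u ((1 - κ) ^ 2) := ((Commute.one_right u).sub_right hc).pow_right 2
  rw [harmonicProj, mul_sub, mul_one, ← mul_assoc, ← hcN.eq, mul_assoc, ← pow_add, hu, sub_self]

theorem harmonicProj_commute (hc : Commute u κ) : Commute (harmonicProj κ u) κ := by
  have h : Commute (1 - κ) κ := (Commute.one_left κ).sub_left (Commute.refl κ)
  exact (Commute.one_left κ).sub_left (hc.mul_left (h.pow_left 2))

theorem map_sub_sq {f : V →ₗ[k] W} (hf : ∀ x, f (κ x) = κ' (f x)) (x : V) :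
    f (((1 - κ : Module.End k V) ^ 2) x) = ((1 - κ' : Module.End k W) ^ 2) (f x) := by
  simp [pow_two, hf]

theorem harmonicProj_apply_of_harmonic {x : V} (hx : ((1 - κ : Module.End k V) ^ 2) x = 0) :
    harmonicProj κ u x = x := by
  simp [harmonicProj, hx]

/-- A map intertwining `κ` and `κ'` preserves both the kernel and the image of the squares, hence
the splitting. No compatibility between `u` and `u'` is needed, so the inverses may be chosen
independently in each degree. -/
theorem harmonicProj_map (hc : Commute u κ) (hu : u * (1 - κ) ^ 4 = (1 - κ) ^ 2)
    (hc' : Commute u' κ') (hu' : u' * (1 - κ') ^ 4 = (1 - κ') ^ 2) {f : V →ₗ[k] W}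
    (hf : ∀ x, f (κ x) = κ' (f x)) (x : V) :
    f (harmonicProj κ u x) = harmonicProj κ' u' (f x) := by
  have h1 : harmonicProj κ' u' (f (harmonicProj κ u x)) = f (harmonicProj κ u x) := by
    refine harmonicProj_apply_of_harmonic ?_
    rw [← map_sub_sq hf, ← Module.End.mul_apply, sq_mul_harmonicProj hc hu, LinearMap.zero_apply,
      map_zero]
  have hN : Commute (harmonicProj κ' u') ((1 - κ') ^ 2) :=
    ((Commute.one_right _).sub_right (harmonicProj_commute hc')).pow_right 2
  have h2 : harmonicProj κ' u' (f (x - harmonicProj κ u x)) = 0 := by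
    have : x - harmonicProj κ u x = ((1 - κ : Module.End k V) ^ 2) (u x) := by
      have hcN : Commute u ((1 - κ) ^ 2) := ((Commute.one_right u).sub_right hc).pow_right 2
      rw [← Module.End.mul_apply, ← hcN.eq]
      simp [harmonicProj]
    rw [this, map_sub_sq hf, ← Module.End.mul_apply, hN.eq, sq_mul_harmonicProj hc' hu',
      LinearMap.zero_apply]
  rw [map_sub, map_sub, h1, sub_eq_zero] at h2
  exact h2.symm

theorem one_sub_harmonicProj : 1 - harmonicProj κ u = u * (1 - κ) ^ 2 := by
  simp [harmonicProj]

theorem harmonicProj_mul_one_sub (hc : Commute u κ) (hu : u * (1 - κ) ^ 4 = (1 - κ) ^ 2) :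
    harmonicProj κ u * (1 - harmonicProj κ u) = 0 := by
  rw [((Commute.one_right _).sub_right (Commute.refl (harmonicProj κ u))).eq, one_sub_harmonicProj,
    mul_assoc, sq_mul_harmonicProj hc hu, mul_zero]

theorem one_sub_mul_one_sub (hc : Commute u κ) (hu : u * (1 - κ) ^ 4 = (1 - κ) ^ 2) :
    (1 - harmonicProj κ u) * (1 - harmonicProj κ u) = 1 - harmonicProj κ u := by
  nth_rw 1 [sub_mul]
  rw [one_mul, harmonicProj_mul_one_sub hc hu, sub_zero]

theorem one_sub_mul_greenOp (hc : Commute u κ) (hu : u * (1 - κ) ^ 4 = (1 - κ) ^ 2) :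
    (1 - κ) * greenOp κ u = 1 - harmonicProj κ u := by
  have hcN : Commute u (1 - κ) := (Commute.one_right u).sub_right hc
  have h : (1 - κ) * (u * (1 - κ)) = 1 - harmonicProj κ u := by
    rw [one_sub_harmonicProj, ← mul_assoc, ← hcN.eq, mul_assoc, ← pow_two]
  rw [greenOp, ← mul_assoc, h, one_sub_mul_one_sub hc hu]

theorem greenOp_mul_one_sub (hc : Commute u κ) (hu : u * (1 - κ) ^ 4 = (1 - κ) ^ 2) :
    greenOp κ u * (1 - harmonicProj κ u) = greenOp κ u := by
  rw [greenOp, mul_assoc, one_sub_mul_one_sub hc hu]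

theorem one_sub_mul_greenOp_eq (hc : Commute u κ) (hu : u * (1 - κ) ^ 4 = (1 - κ) ^ 2) :
    (1 - harmonicProj κ u) * greenOp κ u = greenOp κ u := by
  have hcN : Commute u (1 - κ) := (Commute.one_right u).sub_right hc
  have h1 : Commute (1 - harmonicProj κ u) (u * (1 - κ)) := by
    rw [one_sub_harmonicProj]
    exact ((Commute.refl u).mul_right hcN).mul_left
      ((hcN.symm.pow_left 2).mul_right ((Commute.refl _).pow_left 2))
  rw [greenOp, ← mul_assoc, h1.eq, mul_assoc, one_sub_mul_one_sub hc hu]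

theorem greenOp_commute (hc : Commute u κ) : Commute (greenOp κ u) κ := by
  have h : Commute (1 - κ) κ := (Commute.one_left κ).sub_left (Commute.refl κ)
  exact (hc.mul_left h).mul_left ((Commute.one_left κ).sub_left (harmonicProj_commute hc))

/-- The Green operator inverts `1 - κ` on the image of `1 - P`. Since `f` preserves that image and
intertwines `1 - κ`, it intertwines the inverses. -/
theorem greenOp_map (hc : Commute u κ) (hu : u * (1 - κ) ^ 4 = (1 - κ) ^ 2)
    (hc' : Commute u' κ') (hu' : u' * (1 - κ') ^ 4 = (1 - κ') ^ 2) {f : V →ₗ[k] W}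
    (hf : ∀ x, f (κ x) = κ' (f x)) (x : V) :
    f (greenOp κ u x) = greenOp κ' u' (f x) := by
  have hP := harmonicProj_map hc hu hc' hu' hf
  have h1 : ∀ y, f ((1 - harmonicProj κ u) y) = (1 - harmonicProj κ' u') (f y) := by
    intro y; simp [hP]
  have h2 : ∀ y, f ((1 - κ) y) = (1 - κ') (f y) := by
    intro y; simp [hf]
  have hcg : Commute (greenOp κ' u') (1 - κ') :=
    (Commute.one_right _).sub_right (greenOp_commute hc')
  calc f (greenOp κ u x) = f ((1 - harmonicProj κ u) (greenOp κ u x)) := by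
        rw [← Module.End.mul_apply, one_sub_mul_greenOp_eq hc hu]
    _ = greenOp κ' u' ((1 - κ') (f (greenOp κ u x))) := by
        rw [h1, ← one_sub_mul_greenOp hc' hu', ← hcg.eq, Module.End.mul_apply]
    _ = greenOp κ' u' ((1 - harmonicProj κ' u') (f x)) := by
        rw [← h2, ← Module.End.mul_apply, one_sub_mul_greenOp hc hu, h1]
    _ = greenOp κ' u' (f x) := by
        rw [← Module.End.mul_apply, greenOp_mul_one_sub hc' hu']

/-- On `Ker (1 - κ)²` the powers of `κ` grow linearly, `κ^l x = x - l (1 - κ) x`. Returning to `x`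
at `l = m + 1` forces `(m + 1)(1 - κ) x = 0`, and `m + 1` is invertible. -/
theorem apply_eq_self_of_harmonic [CharZero k] {x : V} {m : ℕ}
    (hx : ((1 - κ : Module.End k V) ^ 2) x = 0)
    (hm : (κ ^ (m + 1)) x = x) : κ x = x := by
  have hN : κ ((1 - κ) x) = (1 - κ) x := by
    rw [pow_two, Module.End.mul_apply] at hx
    exact (sub_eq_zero.mp hx).symm
  have h : ∀ l : ℕ, (κ ^ l) x = x - (l : k) • (1 - κ) x := by
    intro l
    induction l with
    | zero => simp
    | succ l ih =>
      rw [pow_succ', Module.End.mul_apply, ih, map_sub, map_smul, hN]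
      simp only [LinearMap.sub_apply, Module.End.one_apply]
      push_cast
      module
  have h1 := h (m + 1)
  rw [hm, eq_comm, sub_eq_self, smul_eq_zero] at h1
  exact (sub_eq_zero.mp (h1.resolve_left (Nat.cast_ne_zero.mpr m.succ_ne_zero))).symm

theorem pow_apply_eq_self {x : V} (hx : κ x = x) (j : ℕ) : (κ ^ j) x = x := by
  induction j with
  | zero => rfl
  | succ j ih => rw [pow_succ, Module.End.mul_apply, hx, ih]

open Polynomial in
theorem exists_harmonic_inverse [CharZero k] {κ : Module.End k V} {n : ℕ}
    (h : (κ ^ (n + 1) - 1) * (κ ^ (n + 2) - 1) = 0) :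
    ∃ u : Module.End k V, Commute u κ ∧ u * (1 - κ) ^ 4 = (1 - κ) ^ 2 := by
  -- The cofactor of `(X - 1)²`. Its value at `1` is `(n + 1)(n + 2)`, nonzero in characteristic
  -- `0`, so the two are coprime and the Bézout coefficient `a` of `(X - 1)²`, evaluated at `κ`, is
  -- the required inverse.
  let q : k[X] := (∑ i ∈ Finset.range (n + 1), X ^ i) * ∑ i ∈ Finset.range (n + 2), X ^ i
  have hq : (X - C 1 : k[X]) ^ 2 * q = (X ^ (n + 1) - 1) * (X ^ (n + 2) - 1) := by
    rw [← geom_sum_mul, ← geom_sum_mul, C_1]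
    ring
  have hcop : IsCoprime ((X - C 1 : k[X]) ^ 2) q := by
    refine IsCoprime.pow_left ?_
    rw [(irreducible_X_sub_C (1 : k)).coprime_iff_not_dvd, dvd_iff_isRoot, IsRoot.def]
    simp only [q, eval_mul, eval_finsetSum, eval_pow, eval_X, one_pow, Finset.sum_const,
      Finset.card_range, nsmul_eq_mul, mul_one]
    exact mul_ne_zero (Nat.cast_ne_zero.mpr (by omega)) (Nat.cast_ne_zero.mpr (by omega))
  obtain ⟨a, c, hac⟩ := hcop
  refine ⟨aeval κ a, ?_, ?_⟩
  · have : Commute (aeval κ a) (aeval κ (X : k[X])) := by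
      rw [Commute, SemiconjBy, ← map_mul, ← map_mul, mul_comm]
    rwa [aeval_X] at this
  · have h1 : a * (X - C 1) ^ 4 + c * ((X ^ (n + 1) - 1) * (X ^ (n + 2) - 1)) =
        (X - C 1 : k[X]) ^ 2 := by
      rw [← hq]
      linear_combination (X - C 1 : k[X]) ^ 2 * hac
    have h2 := congrArg (aeval κ) h1
    simp only [map_add, map_mul, map_sub, map_pow, aeval_X, map_one] at h2
    rw [h, mul_zero, add_zero] at h2
    have h4 : (κ - 1) ^ 4 = (1 - κ) ^ 4 := by
      rw [← neg_sub, Even.neg_pow (by decide)]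
    have h5 : (κ - 1) ^ 2 = (1 - κ) ^ 2 := by
      rw [← neg_sub, Even.neg_pow (by decide)]
    rwa [h4, h5] at h2

end HarmonicProjection

/-! ### The identities on reduced forms, and the harmonic projection there. -/

section ReducedAlgebra

variable {k : Type v} [Field k] {A : Type u} [Ring A] [Algebra k A]

@[simp]
theorem dRed_redProj (n : ℕ) (ω : Om k A n) :
    dRed n (redProj k A n ω) = redProj k A (n + 1) (d n ω) := by simp [dRed]

@[simp]
theorem bRed_redProj (n : ℕ) (ω : Om k A (n + 1)) :
    bRed n (redProj k A (n + 1) ω) = redProj k A n (b n ω) := by simp [bRed]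

@[simp]
theorem karoubiRed_redProj (n : ℕ) (ω : Om k A n) :
    karoubiRed n (redProj k A n ω) = redProj k A n (karoubi n ω) := by simp [karoubiRed]

@[simp]
theorem karoubiRed_pow_redProj (n j : ℕ) (ω : Om k A n) :
    ((karoubiRed n : Module.End k (RedOm k A n)) ^ j) (redProj k A n ω) =
      redProj k A n (((karoubi n : Module.End k (Om k A n)) ^ j) ω) := by
  induction j generalizing ω with
  | zero => rfl
  | succ j ih => rw [pow_succ, pow_succ, Module.End.mul_apply, Module.End.mul_apply,
      karoubiRed_redProj, ih]

theorem connesRed_apply (n : ℕ) (x : RedOm k A n) : connesRed n x =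
    ∑ j ∈ Finset.range (n + 1),
      ((karoubiRed (n + 1) : Module.End k (RedOm k A (n + 1))) ^ j) (dRed n x) := by
  obtain ⟨ω, rfl⟩ := redProj_surjective n x
  simp [connesRed, connes]

theorem iDeltaRed_apply (n : ℕ) (x : RedOm k A (n + 1)) : iDeltaRed n x =
    -∑ j ∈ Finset.range (n + 1),
      ((karoubiRed n : Module.End k (RedOm k A n)) ^ j) (bRed n x) := by
  obtain ⟨ω, rfl⟩ := redProj_surjective (n + 1) x
  simp [iDeltaRed, iDelta_eq, karoubi_pow_b]

theorem dRed_dRed (n : ℕ) (x : RedOm k A n) : dRed (n + 1) (dRed n x) = 0 := by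
  obtain ⟨ω, rfl⟩ := redProj_surjective n x
  simp [d_d]

theorem bRed_dRed_zero (x : RedOm k A 0) : bRed 0 (dRed 0 x) = 0 := by
  obtain ⟨ω, rfl⟩ := redProj_surjective 0 x
  simp [b_d_zero]

theorem karoubiRed_zero (x : RedOm k A 0) : karoubiRed 0 x = x := by
  obtain ⟨ω, rfl⟩ := redProj_surjective 0 x
  simp

theorem bRed_dRed_add (n : ℕ) (x : RedOm k A (n + 1)) :
    bRed (n + 1) (dRed (n + 1) x) + dRed n (bRed n x) = x - karoubiRed (n + 1) x := by
  obtain ⟨ω, rfl⟩ := redProj_surjective (n + 1) x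
  simp only [dRed_redProj, bRed_redProj, karoubiRed_redProj, ← map_add, ← map_sub, b_d_add_d_b]

theorem dRed_karoubiRed (n : ℕ) (x : RedOm k A n) :
    dRed n (karoubiRed n x) = karoubiRed (n + 1) (dRed n x) := by
  obtain ⟨ω, rfl⟩ := redProj_surjective n x
  simp [karoubi_d]

theorem bRed_karoubiRed (n : ℕ) (x : RedOm k A (n + 1)) :
    bRed n (karoubiRed (n + 1) x) = karoubiRed n (bRed n x) := by
  obtain ⟨ω, rfl⟩ := redProj_surjective (n + 1) x
  simp [karoubi_b]

theorem karoubiRed_pow_dRed (n : ℕ) (x : RedOm k A n) :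
    ((karoubiRed (n + 1) : Module.End k (RedOm k A (n + 1))) ^ (n + 1)) (dRed n x) =
      dRed n x := by
  obtain ⟨ω, rfl⟩ := redProj_surjective n x
  rw [dRed_redProj, karoubiRed_pow_redProj, karoubi_pow_succ_d]

theorem karoubiRed_pow_bRed (n : ℕ) (x : RedOm k A (n + 1)) :
    ((karoubiRed n : Module.End k (RedOm k A n)) ^ (n + 1)) (bRed n x) = bRed n x := by
  obtain ⟨ω, rfl⟩ := redProj_surjective (n + 1) x
  rw [bRed_redProj, karoubiRed_pow_redProj, karoubi_pow_succ_b]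

theorem karoubiRed_comm_pow (n j : ℕ) (x : RedOm k A n) :
    karoubiRed n (((karoubiRed n : Module.End k (RedOm k A n)) ^ j) x) =
      ((karoubiRed n : Module.End k (RedOm k A n)) ^ j) (karoubiRed n x) := by
  rw [← Module.End.mul_apply, ← Module.End.mul_apply, ← pow_succ, ← pow_succ']

theorem connesRed_karoubiRed (n : ℕ) (x : RedOm k A n) :
    connesRed n (karoubiRed n x) = karoubiRed (n + 1) (connesRed n x) := by
  simp only [connesRed_apply, map_sum, dRed_karoubiRed, karoubiRed_comm_pow]

theorem iDeltaRed_karoubiRed (n : ℕ) (x : RedOm k A (n + 1)) :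
    iDeltaRed n (karoubiRed (n + 1) x) = karoubiRed n (iDeltaRed n x) := by
  simp only [iDeltaRed_apply, map_sum, map_neg, bRed_karoubiRed, karoubiRed_comm_pow]

theorem connesRed_dRed (n : ℕ) (x : RedOm k A n) : connesRed (n + 1) (dRed n x) = 0 := by
  simp [connesRed_apply, dRed_dRed]

theorem dRed_karoubiRed_pow (n j : ℕ) (x : RedOm k A n) :
    dRed n (((karoubiRed n : Module.End k (RedOm k A n)) ^ j) x) =
      ((karoubiRed (n + 1) : Module.End k (RedOm k A (n + 1))) ^ j) (dRed n x) := by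
  obtain ⟨ω, rfl⟩ := redProj_surjective n x
  simp [karoubi_pow_d]

theorem dRed_connesRed (n : ℕ) (x : RedOm k A n) : dRed (n + 1) (connesRed n x) = 0 := by
  simp [connesRed_apply, dRed_karoubiRed_pow, dRed_dRed]

variable [CharZero k]

theorem exists_karoubiRed_inverse : (n : ℕ) → ∃ u : Module.End k (RedOm k A n),
    Commute u (karoubiRed n) ∧ u * (1 - karoubiRed n) ^ 4 = (1 - karoubiRed n) ^ 2
  | 0 => by
    -- In degree `0` the operator `1 - κ` vanishes, so any `u` commuting with `κ` would do.
    refine ⟨0, Commute.zero_left _, ?_⟩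
    have h : (karoubiRed 0 : Module.End k (RedOm k A 0)) = 1 := LinearMap.ext karoubiRed_zero
    simp [h]
  | n + 1 => by
    refine exists_harmonic_inverse (n := n) ?_
    ext x
    obtain ⟨ω, rfl⟩ := redProj_surjective (n + 1) x
    have h := congrArg (redProj k A (n + 1)) (karoubi_pow_sub_one n ω)
    simpa only [Module.End.mul_apply, LinearMap.sub_apply, Module.End.one_apply, map_sub,
      ← karoubiRed_pow_redProj, map_zero, LinearMap.zero_apply] using h

/-- An operator inverting `(1 - κ)²` on its image. -/
def harmInv (n : ℕ) : Module.End k (RedOm k A n) :=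
  (exists_karoubiRed_inverse (k := k) (A := A) n).choose

theorem harmInv_commute (n : ℕ) : Commute (harmInv n) (karoubiRed (k := k) (A := A) n) :=
  (exists_karoubiRed_inverse n).choose_spec.1

theorem harmInv_mul (n : ℕ) :
    harmInv n * (1 - karoubiRed (k := k) (A := A) n) ^ 4 = (1 - karoubiRed n) ^ 2 :=
  (exists_karoubiRed_inverse n).choose_spec.2

/-- The harmonic projection on reduced `n`-forms. -/
def harmRed (n : ℕ) : Module.End k (RedOm k A n) := harmonicProj (karoubiRed n) (harmInv n)

/-- The Green operator on reduced `n`-forms. -/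
def greenRed (n : ℕ) : Module.End k (RedOm k A n) := greenOp (karoubiRed n) (harmInv n)

theorem map_harmRed {m n : ℕ} {f : RedOm k A m →ₗ[k] RedOm k A n}
    (hf : ∀ x, f (karoubiRed m x) = karoubiRed n (f x)) (x : RedOm k A m) :
    f (harmRed m x) = harmRed n (f x) :=
  harmonicProj_map (harmInv_commute m) (harmInv_mul m) (harmInv_commute n) (harmInv_mul n) hf x

theorem map_greenRed {m n : ℕ} {f : RedOm k A m →ₗ[k] RedOm k A n}
    (hf : ∀ x, f (karoubiRed m x) = karoubiRed n (f x)) (x : RedOm k A m) :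
    f (greenRed m x) = greenRed n (f x) :=
  greenOp_map (harmInv_commute m) (harmInv_mul m) (harmInv_commute n) (harmInv_mul n) hf x

theorem harmRed_harmonic (n : ℕ) (x : RedOm k A n) :
    ((1 - karoubiRed n : Module.End k (RedOm k A n)) ^ 2) (harmRed n x) = 0 :=
  LinearMap.congr_fun (sq_mul_harmonicProj (harmInv_commute n) (harmInv_mul n)) x

theorem greenRed_sub (n : ℕ) (x : RedOm k A n) :
    greenRed n (x - karoubiRed n x) = x - harmRed n x := by
  have h : Commute (greenRed n) (1 - karoubiRed (k := k) (A := A) n) :=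
    (Commute.one_right _).sub_right (greenOp_commute (harmInv_commute n))
  exact LinearMap.congr_fun
    (h.eq.trans (one_sub_mul_greenOp (harmInv_commute n) (harmInv_mul n))) x

/-- The exact form `d P x` is harmonic and fixed by `κ^(n+1)`, hence by `κ`. The `n + 1` terms `κ^j
d P x` of `B` therefore coincide. -/
theorem connesRed_harmRed (n : ℕ) (x : RedOm k A n) :
    connesRed n (harmRed n x) = ((n + 1 : ℕ) : k) • dRed n (harmRed n x) := by
  have h : karoubiRed (n + 1) (dRed n (harmRed n x)) = dRed n (harmRed n x) := by
    refine apply_eq_self_of_harmonic (m := n) ?_ (karoubiRed_pow_dRed n _)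
    rw [← map_sub_sq (dRed_karoubiRed (k := k) (A := A) n), harmRed_harmonic, map_zero]
  simp [connesRed_apply, pow_apply_eq_self h, ← Nat.cast_smul_eq_nsmul k]

/-- The same argument for `b P x`, which `κ^(n+1)` fixes as well, using the expression of `ı_Δ`
through `κ^j b`. -/
theorem iDeltaRed_harmRed (n : ℕ) (x : RedOm k A (n + 1)) :
    iDeltaRed n (harmRed (n + 1) x) = -(((n + 1 : ℕ) : k) • bRed n (harmRed (n + 1) x)) := by
  have h : karoubiRed n (bRed n (harmRed (n + 1) x)) = bRed n (harmRed (n + 1) x) := by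
    refine apply_eq_self_of_harmonic (m := n) ?_ (karoubiRed_pow_bRed n _)
    rw [← map_sub_sq (bRed_karoubiRed (k := k) (A := A) n), harmRed_harmonic, map_zero]
  simp [iDeltaRed_apply, pow_apply_eq_self h, ← Nat.cast_smul_eq_nsmul k]

theorem connesRed_greenRed_dRed (n : ℕ) (x : RedOm k A n) :
    connesRed (n + 1) (greenRed (n + 1) (dRed n x)) = 0 := by
  rw [map_greenRed (connesRed_karoubiRed _), connesRed_dRed, map_zero]

theorem greenRed_dRed_connesRed (n : ℕ) (x : RedOm k A n) :
    greenRed (n + 2) (dRed (n + 1) (connesRed n x)) = 0 := by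
  rw [dRed_connesRed, map_zero]

theorem bRed_greenRed_dRed_zero (x : RedOm k A 0) :
    bRed 0 (greenRed 1 (dRed 0 x)) = x - harmRed 0 x := by
  rw [map_greenRed (bRed_karoubiRed _), bRed_dRed_zero, map_zero, ← greenRed_sub, karoubiRed_zero,
    sub_self, map_zero]

/-- The operator `G` commutes with `b`, so the left side is `G (b d + d b) = G (1 - κ)`. This is the
contraction of the complement of the harmonic part. -/
theorem bRed_greenRed_dRed_add (n : ℕ) (x : RedOm k A (n + 1)) :
    bRed (n + 1) (greenRed (n + 2) (dRed (n + 1) x)) + greenRed (n + 1) (dRed n (bRed n x)) =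
      x - harmRed (n + 1) x := by
  rw [map_greenRed (bRed_karoubiRed _), ← map_add, bRed_dRed_add, greenRed_sub]

end ReducedAlgebra

/-! ### Abstract comparison of cohomology with harmonic cohomology. -/

section Comparison

variable {k : Type v} [Field k] {E : Type u} [AddCommGroup E] [Module k E]

/-- Operators comparing the harmonic part of the cohomology of `D'` with the cohomology of `D`:
a projection `P` onto the harmonic part which is homotopic to the identity with respect to `D`, and
a rescaling `φ` which intertwines `D'` and `D` on the harmonic part, up to scalars depending on the
degree. -/
structure HarmonicComparison (D D' κ : E →ₗ[k] E) (G : ℤ → Submodule k E) where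
  /-- The harmonic projection. -/
  P : E →ₗ[k] E
  /-- An operator exhibiting the kernel of `P` as a complement of the harmonic part. -/
  U : E →ₗ[k] E
  /-- The homotopy from `P` to the identity. -/
  h : E →ₗ[k] E
  /-- The rescaling. -/
  φ : E →ₗ[k] E
  /-- The inverse of the rescaling. -/
  ψ : E →ₗ[k] E
  φ_ψ : ∀ x, φ (ψ x) = x
  ψ_φ : ∀ x, ψ (φ x) = x
  P_mem : ∀ m, ∀ x ∈ G m, P x ∈ G m
  h_mem : ∀ m, ∀ x ∈ G m, h x ∈ G (m - 1)
  φ_mem : ∀ m, ∀ x ∈ G m, φ x ∈ G m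
  ψ_mem : ∀ m, ∀ x ∈ G m, ψ x ∈ G m
  P_harmonic : ∀ x, P x ∈ harmonicPart κ
  P_eq : ∀ x, P x = x - U (x - κ x - κ (x - κ x))
  D_P : ∀ x, D (P x) = P (D x)
  D'_P : ∀ x, D' (P x) = P (D' x)
  φ_P : ∀ x, φ (P x) = P (φ x)
  homotopy : ∀ x, D (h x) + h (D x) = x - P x
  compare : ∀ m, ∃ s : k, s ≠ 0 ∧ ∀ x ∈ G m, D (φ (P x)) = s • φ (D' (P x))

namespace HarmonicComparison

variable {D D' κ : E →ₗ[k] E} {G : ℤ → Submodule k E} (C : HarmonicComparison D D' κ G)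

theorem P_of_harmonic {x : E} (hx : x ∈ harmonicPart κ) : C.P x = x := by
  have h : x - κ x - κ (x - κ x) = 0 := hx
  rw [C.P_eq, h, map_zero, sub_zero]

theorem ψ_P (x : E) : C.ψ (C.P x) = C.P (C.ψ x) := by
  rw [← C.ψ_φ (C.P (C.ψ x)), C.φ_P, C.φ_ψ]

theorem compare_of_harmonic {m : ℤ} : ∃ s : k, s ≠ 0 ∧
    ∀ x ∈ G m, x ∈ harmonicPart κ → D (C.φ x) = s • C.φ (D' x) := by
  obtain ⟨s, hs, h⟩ := C.compare m
  refine ⟨s, hs, fun x hx hκ => ?_⟩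
  have := h x hx
  rwa [C.P_of_harmonic hκ] at this

theorem φ_cycles (m : ℤ) {x : E} (hx : x ∈ cycles D' G m) (hκ : x ∈ harmonicPart κ) :
    C.φ x ∈ cycles D G m := by
  obtain ⟨s, -, h⟩ := C.compare_of_harmonic (m := m)
  refine ⟨?_, C.φ_mem m x hx.2⟩
  have h0 : D' x = 0 := hx.1
  change D (C.φ x) = 0
  rw [h x hx.2 hκ, h0, map_zero, smul_zero]

/-- The harmonic cycles of `D'`. -/
abbrev harmonicCycles (D' κ : E →ₗ[k] E) (G : ℤ → Submodule k E) (m : ℤ) :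
    Submodule k (cycles D' G m) := (harmonicPart κ).submoduleOf (cycles D' G m)

/-- The class in the harmonic cohomology of a harmonic cycle. -/
def toHarmonic (D' κ : E →ₗ[k] E) (G : ℤ → Submodule k E) (m : ℤ) :
    harmonicCycles D' κ G m →ₗ[k] harmonicCohomology D' κ G m :=
  (((boundaries D' G m).submoduleOf (cycles D' G m)).mkQ).submoduleMap _

theorem toHarmonic_surjective (D' κ : E →ₗ[k] E) (G : ℤ → Submodule k E) (m : ℤ) :
    Function.Surjective (toHarmonic D' κ G m) :=
  LinearMap.submoduleMap_surjective _ _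

/-- The class of the rescaling of a harmonic cycle. -/
def toCohomology (m : ℤ) : harmonicCycles D' κ G m →ₗ[k] Cohomology D G m :=
  ((boundaries D G m).submoduleOf (cycles D G m)).mkQ ∘ₗ
    LinearMap.codRestrict (cycles D G m)
      (C.φ ∘ₗ (cycles D' G m).subtype ∘ₗ (harmonicCycles D' κ G m).subtype)
      fun x => C.φ_cycles m x.1.2 x.2

/-- By the homotopy every `D`-cycle `y` is homologous to `P y`, and `P y = φ (ψ (P y))`, where `ψ (P
y)` is a harmonic `D'`-cycle because `s ≠ 0`. -/
theorem toCohomology_surjective (m : ℤ) : Function.Surjective (C.toCohomology m) := by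
  intro y
  obtain ⟨⟨y, hy⟩, rfl⟩ := Submodule.mkQ_surjective _ y
  obtain ⟨s, hs, h⟩ := C.compare_of_harmonic (m := m)
  have hDy : D y = 0 := hy.1
  have hψ : C.ψ (C.P y) ∈ G m := C.ψ_mem m _ (C.P_mem m y hy.2)
  have hκ : C.ψ (C.P y) ∈ harmonicPart κ := by
    rw [C.ψ_P]; exact C.P_harmonic _
  have hD' : D' (C.ψ (C.P y)) = 0 := by
    have h1 := h _ hψ hκ
    rw [C.φ_ψ, C.D_P, hDy, map_zero, eq_comm, smul_eq_zero] at h1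
    rw [← C.ψ_φ (D' _), h1.resolve_left hs, map_zero]
  refine ⟨⟨⟨C.ψ (C.P y), hD', hψ⟩, hκ⟩, ?_⟩
  refine (Submodule.Quotient.eq _).mpr ⟨-C.h y, neg_mem (C.h_mem m y hy.2), ?_⟩
  have h2 := C.homotopy y
  rw [hDy, map_zero, add_zero] at h2
  change D (-C.h y) = C.φ (C.ψ (C.P y)) - y
  rw [map_neg, h2, C.φ_ψ, neg_sub]

/-- A harmonic boundary has a harmonic primitive, since `P` commutes with both differentials. On
harmonic primitives `φ` exchanges the two notions of boundary up to the scalar `s` attached to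
degree `m - 1`. -/
theorem ker_toHarmonic (m : ℤ) :
    LinearMap.ker (toHarmonic D' κ G m) = LinearMap.ker (C.toCohomology m) := by
  obtain ⟨s, hs, h⟩ := C.compare_of_harmonic (m := m - 1)
  ext ⟨⟨z, hz⟩, hκ⟩
  have hκ : z ∈ harmonicPart κ := hκ
  have h1 : (⟨⟨z, hz⟩, hκ⟩ : harmonicCycles D' κ G m) ∈ LinearMap.ker (toHarmonic D' κ G m) ↔
      z ∈ boundaries D' G m := by
    rw [LinearMap.mem_ker, Subtype.ext_iff]
    exact Submodule.Quotient.mk_eq_zero _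
  have h2 : (⟨⟨z, hz⟩, hκ⟩ : harmonicCycles D' κ G m) ∈ LinearMap.ker (C.toCohomology m) ↔
      C.φ z ∈ boundaries D G m :=
    Submodule.Quotient.mk_eq_zero _
  rw [h1, h2]
  constructor
  · rintro ⟨y, hy, rfl⟩
    refine ⟨s⁻¹ • C.φ (C.P y), Submodule.smul_mem _ _ (C.φ_mem _ _ (C.P_mem _ y hy)), ?_⟩
    rw [map_smul, h _ (C.P_mem _ y hy) (C.P_harmonic y), smul_smul, inv_mul_cancel₀ hs, one_smul,
      C.D'_P, C.P_of_harmonic hκ]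
  · rintro ⟨w, hw, hwz⟩
    have hκ' : C.ψ (C.P w) ∈ harmonicPart κ := by
      rw [C.ψ_P]; exact C.P_harmonic _
    have hm : C.ψ (C.P w) ∈ G (m - 1) := C.ψ_mem _ _ (C.P_mem _ w hw)
    refine ⟨s • C.ψ (C.P w), Submodule.smul_mem _ _ hm, ?_⟩
    have h3 := h _ hm hκ'
    rw [C.φ_ψ, C.D_P, hwz, ← C.φ_P, C.P_of_harmonic hκ, ← map_smul, ← map_smul] at h3
    rw [← C.ψ_φ (D' _), ← h3, C.ψ_φ]

/-- The harmonic part of the cohomology of `D'` is isomorphic to the cohomology of `D`. -/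
def equiv (m : ℤ) : harmonicCohomology D' κ G m ≃ₗ[k] Cohomology D G m :=
  ((toHarmonic D' κ G m).quotKerEquivOfSurjective (toHarmonic_surjective D' κ G m)).symm ≪≫ₗ
    Submodule.quotEquivOfEq _ _ (C.ker_toHarmonic m) ≪≫ₗ
    (C.toCohomology m).quotKerEquivOfSurjective (C.toCohomology_surjective m)

theorem equiv_toHarmonic (m : ℤ) (z : harmonicCycles D' κ G m) :
    C.equiv m (toHarmonic D' κ G m z) = C.toCohomology m z := by
  have h : ((toHarmonic D' κ G m).quotKerEquivOfSurjective
      (toHarmonic_surjective D' κ G m)).symm (toHarmonic D' κ G m z) = Submodule.Quotient.mk z := by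
    rw [LinearEquiv.symm_apply_eq]
    rfl
  simp only [equiv, LinearEquiv.trans_apply, h]
  rfl

/-- Both sides send the class of a harmonic cycle `z` to the class of `f (φ z)`, so `f` need only
respect `φ`, `κ`, the differentials and the grading, not `P`, `U` or `h`. The shift `s` covers
multiplication by `t` (`s = 2`) as well as algebra maps (`s = 0`). -/
theorem equiv_map {E₁ : Type u} [AddCommGroup E₁] [Module k E₁] {D₁ D₁' κ₁ : E₁ →ₗ[k] E₁}
    {G₁ : ℤ → Submodule k E₁} (C₁ : HarmonicComparison D₁ D₁' κ₁ G₁) (f : E →ₗ[k] E₁) (s : ℤ)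
    (hD : ∀ x, f (D x) = D₁ (f x)) (hD' : ∀ x, f (D' x) = D₁' (f x))
    (hG : ∀ m, G m ≤ (G₁ (m + s)).comap f) (m m' : ℤ) (hm : m' = m + s)
    (hκ : ∀ x, f (κ x) = κ₁ (f x)) (hφ : ∀ x, f (C.φ x) = C₁.φ (f x))
    (x : harmonicCohomology D' κ G m) :
    C₁.equiv m' (harmonicMap f s hD' hG m m' hm hκ x) =
      cohomologyMap f s hD hG m m' hm (C.equiv m x) := by
  obtain ⟨⟨⟨z, hz⟩, hzκ⟩, rfl⟩ := toHarmonic_surjective D' κ G m x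
  rw [equiv_toHarmonic]
  have hfz : f z ∈ harmonicPart κ₁ := by
    have h : z - κ z - κ (z - κ z) = 0 := hzκ
    change f z - κ₁ (f z) - κ₁ (f z - κ₁ (f z)) = 0
    simpa [hκ] using congrArg f h
  refine (C₁.equiv_toHarmonic m' ⟨⟨f z, cycles_le f s hD' hG m m' hm z hz⟩, hfz⟩).trans ?_
  refine congrArg (Submodule.Quotient.mk) (Subtype.ext ?_)
  exact (hφ z).symm

/-- Restriction of the degree parts to an invariant subspace. -/
def restrict (S : Submodule k E) (hP : S ≤ S.comap C.P) (hh : S ≤ S.comap C.h)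
    (hφ : S ≤ S.comap C.φ) (hψ : S ≤ S.comap C.ψ) :
    HarmonicComparison D D' κ (fun m => G m ⊓ S) :=
  { C with
    P_mem := fun m x hx => ⟨C.P_mem m x hx.1, hP hx.2⟩
    h_mem := fun m x hx => ⟨C.h_mem m x hx.1, hh hx.2⟩
    φ_mem := fun m x hx => ⟨C.φ_mem m x hx.1, hφ hx.2⟩
    ψ_mem := fun m x hx => ⟨C.ψ_mem m x hx.1, hψ hx.2⟩
    compare := fun m => by
      obtain ⟨s, hs, h⟩ := C.compare m
      exact ⟨s, hs, fun x hx => h x hx.1⟩ }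

theorem mapQ_mem {S : Submodule k E} {f : E →ₗ[k] E} (hf : S ≤ S.comap f) {m m' : ℤ}
    (h : ∀ x ∈ G m, f x ∈ G m') : ∀ x ∈ (G m).map S.mkQ, S.mapQ S f hf x ∈ (G m').map S.mkQ := by
  rintro _ ⟨x, hx, rfl⟩
  exact ⟨f x, h x hx, rfl⟩

/-- The induced comparison on the quotient by an invariant subspace. -/
def quot (S : Submodule k E) (hD : S ≤ S.comap D) (hD' : S ≤ S.comap D') (hκ : S ≤ S.comap κ)
    (hP : S ≤ S.comap C.P) (hU : S ≤ S.comap C.U) (hh : S ≤ S.comap C.h)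
    (hφ : S ≤ S.comap C.φ) (hψ : S ≤ S.comap C.ψ) :
    HarmonicComparison (S.mapQ S D hD) (S.mapQ S D' hD') (S.mapQ S κ hκ)
      (fun m => (G m).map S.mkQ) where
  P := S.mapQ S C.P hP
  U := S.mapQ S C.U hU
  h := S.mapQ S C.h hh
  φ := S.mapQ S C.φ hφ
  ψ := S.mapQ S C.ψ hψ
  φ_ψ x := by
    obtain ⟨x, rfl⟩ := S.mkQ_surjective x
    exact congrArg S.mkQ (C.φ_ψ x)
  ψ_φ x := by
    obtain ⟨x, rfl⟩ := S.mkQ_surjective x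
    exact congrArg S.mkQ (C.ψ_φ x)
  P_mem m := mapQ_mem hP (C.P_mem m)
  h_mem m := mapQ_mem hh (C.h_mem m)
  φ_mem m := mapQ_mem hφ (C.φ_mem m)
  ψ_mem m := mapQ_mem hψ (C.ψ_mem m)
  P_harmonic x := by
    obtain ⟨x, rfl⟩ := S.mkQ_surjective x
    exact congrArg S.mkQ (C.P_harmonic x)
  P_eq x := by
    obtain ⟨x, rfl⟩ := S.mkQ_surjective x
    exact congrArg S.mkQ (C.P_eq x)
  D_P x := by
    obtain ⟨x, rfl⟩ := S.mkQ_surjective x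
    exact congrArg S.mkQ (C.D_P x)
  D'_P x := by
    obtain ⟨x, rfl⟩ := S.mkQ_surjective x
    exact congrArg S.mkQ (C.D'_P x)
  φ_P x := by
    obtain ⟨x, rfl⟩ := S.mkQ_surjective x
    exact congrArg S.mkQ (C.φ_P x)
  homotopy x := by
    obtain ⟨x, rfl⟩ := S.mkQ_surjective x
    exact congrArg S.mkQ (C.homotopy x)
  compare m := by
    obtain ⟨s, hs, h⟩ := C.compare m
    refine ⟨s, hs, ?_⟩
    rintro _ ⟨x, hx, rfl⟩
    exact congrArg S.mkQ (h x hx)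

end HarmonicComparison

end Comparison

/-! ### The comparison for families over `k[t, t⁻¹]`, and its naturality. -/

section LaurentComparison

variable {k : Type v} [Field k] {A : Type u} [Ring A] [Algebra k A]

/-- The `k[t,t⁻¹]`-linear extension of a family of operators of degree `0`. -/
def diagL (f : (j : ℕ) → Module.End k (RedOm k A j)) : Laurent k A →ₗ[k] Laurent k A where
  toFun x i j := f j (x i j)
  map_add' _ _ := by ext; simp
  map_smul' _ _ := by ext; simp

theorem diagL_degPart (f : (j : ℕ) → Module.End k (RedOm k A j)) (m : ℤ) :
    degPart k A m ≤ (degPart k A m).comap (diagL f) :=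
  fun x hx i j h => by simp [diagL, hx i j h]

theorem diagL_plusPart (f : (j : ℕ) → Module.End k (RedOm k A j)) :
    plusPart k A ≤ (plusPart k A).comap (diagL f) :=
  fun x hx i j h => by simp [diagL, hx i j h]

theorem diagL_nonnegPart (f : (j : ℕ) → Module.End k (RedOm k A j)) :
    nonnegPart k A ≤ (nonnegPart k A).comap (diagL f) :=
  fun x hx i j h => by simp [diagL, hx i j h]

theorem totalD_diagL {δ : (j : ℕ) → RedOm k A j →ₗ[k] RedOm k A (j + 1)}
    {β : (j : ℕ) → RedOm k A (j + 1) →ₗ[k] RedOm k A j} {f : (j : ℕ) → Module.End k (RedOm k A j)}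
    (hδ : ∀ j x, δ j (f j x) = f (j + 1) (δ j x)) (hβ : ∀ j x, β j (f (j + 1) x) = f j (β j x))
    (x : Laurent k A) : totalD δ β (diagL f x) = diagL f (totalD δ β x) := by
  ext i j
  cases j <;> simp [totalD, diagL, hδ, hβ]

/-- The operator `t⁻¹ δ`, for `δ` of degree `1`. -/
def tInvRaise (δ : (j : ℕ) → RedOm k A j →ₗ[k] RedOm k A (j + 1)) :
    Laurent k A →ₗ[k] Laurent k A where
  toFun x i j :=
    match j with
    | 0 => 0
    | j + 1 => δ j (x (i + 1) j)
  map_add' x y := by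
    ext i j
    cases j <;> simp
  map_smul' c x := by
    ext i j
    cases j <;> simp

variable {δ : (j : ℕ) → RedOm k A j →ₗ[k] RedOm k A (j + 1)}

theorem tInvRaise_degPart (m : ℤ) :
    degPart k A m ≤ (degPart k A (m - 1)).comap (tInvRaise δ) := by
  intro x hx i j h
  cases j with
  | zero => rfl
  | succ j =>
    have h1 := hx (i + 1) j (by push_cast at h ⊢; omega)
    simp [tInvRaise, h1]

/-- The support condition `i < j + 2 i` depends only on `i + j`, which `t⁻¹ δ` preserves. This is
why the homotopy survives the negative power of `t`, here and on `nonnegPart`. -/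
theorem tInvRaise_plusPart : plusPart k A ≤ (plusPart k A).comap (tInvRaise δ) := by
  intro x hx i j h
  cases j with
  | zero => rfl
  | succ j =>
    have h1 := hx (i + 1) j (by push_cast at h ⊢; omega)
    simp [tInvRaise, h1]

theorem tInvRaise_nonnegPart : nonnegPart k A ≤ (nonnegPart k A).comap (tInvRaise δ) := by
  intro x hx i j h
  cases j with
  | zero => rfl
  | succ j =>
    have h1 := hx (i + 1) j (by push_cast at h ⊢; omega)
    simp [tInvRaise, h1]

variable (k) in
/-- The scalar `(-1)^⌊j/2⌋ j!` by which forms of degree `j` are rescaled. -/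
def scale (j : ℕ) : k := (-1) ^ (j / 2) * (j.factorial : k)

/-- This ratio supplies the factor `j + 1` relating `B` to `d` and `ı_Δ` to `b`. Its sign absorbs
the minus sign of `ı_Δ` relative to `B`. -/
theorem scale_succ (j : ℕ) : scale k (j + 1) = (-1) ^ j * ((j + 1 : ℕ) : k) * scale k j := by
  rw [scale, scale, Nat.factorial_succ, Nat.cast_mul]
  have h : (-1 : k) ^ ((j + 1) / 2) = (-1) ^ j * (-1) ^ (j / 2) := by
    rw [← pow_add]
    refine (neg_one_pow_congr ?_)
    grind
  rw [h]
  ring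

theorem neg_one_pow_sq (j : ℕ) : (-1 : k) ^ j * (-1) ^ j = 1 := by
  rw [← mul_pow]; simp

variable [CharZero k]

theorem scale_ne_zero (j : ℕ) : scale k j ≠ 0 :=
  mul_ne_zero (pow_ne_zero _ (by simp)) (Nat.cast_ne_zero.mpr j.factorial_ne_zero)

variable (k A)

/-- The harmonic comparison of the differentials `B + t b` and `d + t ı_Δ`. -/
def laurentComparison :
    HarmonicComparison (cycD k A) (heartD k A) (karoubiL k A) (degPart k A) where
  P := diagL harmRed
  U := diagL harmInv
  h := tInvRaise fun j => greenRed (j + 1) ∘ₗ dRed j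
  φ := diagL fun j => scale k j • LinearMap.id
  ψ := diagL fun j => (scale k j)⁻¹ • LinearMap.id
  φ_ψ x := by ext i j; simp [diagL, smul_smul, scale_ne_zero]
  ψ_φ x := by ext i j; simp [diagL, smul_smul, scale_ne_zero]
  P_mem m := diagL_degPart _ m
  h_mem m := tInvRaise_degPart m
  φ_mem m := diagL_degPart _ m
  ψ_mem m := diagL_degPart _ m
  P_harmonic x := by
    change _ = _
    ext i j
    have := harmRed_harmonic j (x i j)
    rwa [pow_two] at this
  P_eq x := by
    ext i j
    change harmonicProj _ _ _ = _
    rw [harmonicProj, pow_two]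
    rfl
  D_P := totalD_diagL (fun j => map_harmRed (connesRed_karoubiRed j))
    (fun j => map_harmRed (bRed_karoubiRed j))
  D'_P := totalD_diagL (fun j => map_harmRed (dRed_karoubiRed j))
    (fun j => map_harmRed (iDeltaRed_karoubiRed j))
  φ_P x := by ext i j; simp [diagL]
  homotopy x := by
    ext i j
    -- The target degree decides which terms occur: the `B`-terms `B G d` and `G d B` exist only for
    -- `j ≥ 2`, where they vanish, and `G d b` only for `j ≥ 1`.
    rcases j with _ | _ | j
    · have := bRed_greenRed_dRed_zero (x i 0)
      simpa [cycD, totalD, tInvRaise, diagL] using this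
    · have := bRed_greenRed_dRed_add 0 (x i 1)
      simpa [cycD, totalD, tInvRaise, diagL] using this
    · have := bRed_greenRed_dRed_add (j + 1) (x i (j + 2))
      simpa [cycD, totalD, tInvRaise, diagL, connesRed_greenRed_dRed, greenRed_dRed_connesRed]
        using this
  compare m := by
    -- In total degree `m` only forms with `j ≡ m` modulo `2` occur, so the sign `(-1)^j` left by
    -- the rescaling is the constant `(-1)^m`.
    refine ⟨(-1) ^ m.natAbs, pow_ne_zero _ (by simp), fun x hx => ?_⟩
    have hB : ∀ i j, scale k j • connesRed j (harmRed j (x i j)) =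
        ((-1 : k) ^ m.natAbs * scale k (j + 1)) • dRed j (harmRed j (x i j)) := by
      intro i j
      by_cases h : (j : ℤ) + 2 * i = m
      · have hm : (-1 : k) ^ m.natAbs = (-1) ^ j := neg_one_pow_congr (by grind)
        rw [connesRed_harmRed, smul_smul, hm, scale_succ, ← mul_assoc, ← mul_assoc,
          neg_one_pow_sq, one_mul, mul_comm]
      · simp [hx i j h]
    have hb : ∀ i j, scale k (j + 1) • bRed j (harmRed (j + 1) (x i (j + 1))) =
        ((-1 : k) ^ m.natAbs * scale k j) • iDeltaRed j (harmRed (j + 1) (x i (j + 1))) := by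
      intro i j
      by_cases h : ((j + 1 : ℕ) : ℤ) + 2 * i = m
      · have hm : (-1 : k) ^ m.natAbs = (-1) ^ (j + 1) := neg_one_pow_congr (by grind)
        rw [iDeltaRed_harmRed, smul_neg, smul_smul, ← neg_smul, hm, scale_succ, pow_succ]
        congr 1
        ring
      · simp [hx i (j + 1) h]
    ext i j
    cases j with
    | zero => simpa [cycD, heartD, totalD, diagL, smul_smul] using hb (i - 1) 0
    | succ j =>
      simpa [cycD, heartD, totalD, diagL, smul_smul] using
        congrArg₂ (· + ·) (hB i j) (hb (i - 1) (j + 1))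

/-- The harmonic comparison for negative cyclic homology. -/
def negComparison :
    HarmonicComparison (cycD k A) (heartD k A) (karoubiL k A) (nonnegDeg k A) :=
  (laurentComparison k A).restrict (nonnegPart k A) (diagL_nonnegPart _) tInvRaise_nonnegPart
    (diagL_nonnegPart _) (diagL_nonnegPart _)

/-- The harmonic comparison for cyclic homology. -/
def quotComparison :
    HarmonicComparison (cycDQuot k A) (heartDQuot k A) (karoubiQuot k A) (quotDeg k A) :=
  (laurentComparison k A).quot (plusPart k A) (totalD_plusPart _ _) (totalD_plusPart _ _)
    karoubiL_plusPart (diagL_plusPart _) (diagL_plusPart _) tInvRaise_plusPart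
    (diagL_plusPart _) (diagL_plusPart _)

variable {k A} {A' : Type u} [Ring A'] [Algebra k A']

/-- The scalars depend only on the form degree, which algebra maps preserve. -/
theorem laurentMap_scale (f : A →ₐ[k] A') (x : Laurent k A) :
    laurentMap f ((laurentComparison k A).φ x) = (laurentComparison k A').φ (laurentMap f x) := by
  ext i j
  simp [laurentMap, laurentComparison, diagL]

theorem quotComparison_equiv_t (n : ℤ) (x : PHeartHC k A n) :
    (quotComparison k A).equiv (-(n - 2)) (PHeartHC.t n x) =
      HC.t n ((quotComparison k A).equiv (-n) x) :=
  (quotComparison k A).equiv_map (quotComparison k A) (tQuot k A) 2 cycDQuot_t heartDQuot_t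
    quotDeg_t (-n) (-(n - 2)) (by ring) karoubiQuot_t (fun y => by
      obtain ⟨y, rfl⟩ := Submodule.mkQ_surjective _ y
      rfl) x

theorem quotComparison_equiv_map (f : A →ₐ[k] A') (n : ℤ) (x : PHeartHC k A n) :
    (quotComparison k A').equiv (-n) (PHeartHC.map f n x) =
      HC.map f n ((quotComparison k A).equiv (-n) x) :=
  (quotComparison k A).equiv_map (quotComparison k A') (quotMap f) 0 (quotMap_cycDQuot f)
    (quotMap_heartDQuot f) (quotMap_quotDeg f) (-n) (-n) (by ring) (quotMap_karoubiQuot f)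
    (fun y => by
      obtain ⟨y, rfl⟩ := Submodule.mkQ_surjective _ y
      exact congrArg (plusPart k A').mkQ (laurentMap_scale f y)) x

theorem negComparison_equiv_t (n : ℤ) (x : PHeartHCneg k A n) :
    (negComparison k A).equiv (-(n - 2)) (PHeartHCneg.t n x) =
      HCneg.t n ((negComparison k A).equiv (-n) x) :=
  (negComparison k A).equiv_map (negComparison k A) (tMul k A) 2
    (fun x => (totalD_tMul _ _ x).symm) (fun x => (totalD_tMul _ _ x).symm) nonnegDeg_t
    (-n) (-(n - 2)) (by ring) (fun x => (karoubiL_tMul x).symm) (fun _ => rfl) x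

theorem negComparison_equiv_map (f : A →ₐ[k] A') (n : ℤ) (x : PHeartHCneg k A n) :
    (negComparison k A').equiv (-n) (PHeartHCneg.map f n x) =
      HCneg.map f n ((negComparison k A).equiv (-n) x) :=
  (negComparison k A).equiv_map (negComparison k A') (laurentMap f) 0 (laurentMap_cycD f)
    (laurentMap_heartD f) (laurentMap_nonnegDeg f) (-n) (-n) (by ring) (laurentMap_karoubiL f)
    (laurentMap_scale f) x

end LaurentComparison

end

end NCForms

/-- The harmonic parts of `♥HC` and `♥HC^-` are naturally isomorphic to `HC` and `HC^-`, as graded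
`k[t]`-modules: the isomorphisms are given degree by degree, commute with the action of `t`, and
are natural with respect to algebra homomorphisms. -/
theorem proposition5 (k : Type v) [Field k] [CharZero k] :
    (∃ e : ∀ (A : Type u) [Ring A] [Algebra k A] (n : ℤ),
        NCForms.PHeartHC k A n ≃ₗ[k] NCForms.HC k A n,
      (∀ (A : Type u) [Ring A] [Algebra k A] (n : ℤ) (x : NCForms.PHeartHC k A n),
        e A (n - 2) (NCForms.PHeartHC.t n x) = NCForms.HC.t n (e A n x)) ∧
      (∀ (A A' : Type u) [Ring A] [Algebra k A] [Ring A'] [Algebra k A'] (f : A →ₐ[k] A')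
        (n : ℤ) (x : NCForms.PHeartHC k A n),
        e A' n (NCForms.PHeartHC.map f n x) = NCForms.HC.map f n (e A n x))) ∧
    (∃ e : ∀ (A : Type u) [Ring A] [Algebra k A] (n : ℤ),
        NCForms.PHeartHCneg k A n ≃ₗ[k] NCForms.HCneg k A n,
      (∀ (A : Type u) [Ring A] [Algebra k A] (n : ℤ) (x : NCForms.PHeartHCneg k A n),
        e A (n - 2) (NCForms.PHeartHCneg.t n x) = NCForms.HCneg.t n (e A n x)) ∧
      (∀ (A A' : Type u) [Ring A] [Algebra k A] [Ring A'] [Algebra k A'] (f : A →ₐ[k] A')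
        (n : ℤ) (x : NCForms.PHeartHCneg k A n),
        e A' n (NCForms.PHeartHCneg.map f n x) = NCForms.HCneg.map f n (e A n x))) := by
  refine ⟨⟨fun A _ _ n => (NCForms.quotComparison k A).equiv (-n), ?_, ?_⟩,
    ⟨fun A _ _ n => (NCForms.negComparison k A).equiv (-n), ?_, ?_⟩⟩
  · intro A _ _ n x
    exact NCForms.quotComparison_equiv_t n x
  · intro A A' _ _ _ _ f n x
    exact NCForms.quotComparison_equiv_map f n x
  · intro A _ _ n x
    exact NCForms.negComparison_equiv_t n x
  · intro A A' _ _ _ _ f n x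
    exact NCForms.negComparison_equiv_map f n x
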